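/- **Theorem (Oracle CIs on the estimated support).** Let $(I,X,Y)$ and $(\tilde I,\tilde X)$ be random vectors, $I,\tilde I\in\mathbb R^m$, $X,\tilde X\in\mathbb R^d$, $Y\in\mathbb R$ ($m,d$ fixed), with $\mathbb E\|X\|^2<\infty$ and finite fourth moments of $I,Y,\tilde I,\tilde X$, and let $\beta^*\in\mathbb R^d$, $\epsilon:=Y-X^\top\beta^*$, be such that $\operatorname{Cov}(\tilde I,\tilde X)=\operatorname{Cov}(I,X)$ and $\mathbb E[\epsilon\mid I]=0$. Let $(I_i,Y_i)_{i\ge1}$ and $(\tilde I_j,\tilde X_j)_{j\ge1}$ be i.i.d. copies of $(I,Y)$ and $(\tilde I,\tilde X)$, the two sequences being independent of each other. Let the sample sizes satisfy $n,\tilde n\to\infty$, $N:=n+\tilde n$, $n/N\to\tau\in(0,1)$, $\tilde n/N\to\tilde\tau\in(0,1)$. The variables are centred in one of two ways: either $I,Y,\tilde I,\tilde X$ have mean zero and the data are used as they are, or the data are centred by subtracting their sample means. With the data so centred, put $\widehat{\operatorname{Cov}}(I,Y)=\frac1n\sum_{i\le n}I_iY_i$, $\widehat{\operatorname{Cov}}(\tilde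 I,\tilde X)=\frac1{\tilde n}\sum_{j\le\tilde n}\tilde I_j\tilde X_j^\top$ and $\hat g_N(\beta)=\widehat{\operatorname{Cov}}(I,Y)-\widehat{\operatorname{Cov}}(\tilde I,\tilde X)\beta$. Let $\Omega:=\tau^{-1}\operatorname{Var}(IY)+\tilde\tau^{-1}\operatorname{Var}(\tilde I\tilde X^\top\beta^*)$, where $I,Y,\tilde I,\tilde X$ stand for the variables minus their expectations. Let $S^*=\operatorname{supp}(\beta^*)$ and $s^*=|S^*|$. Let $W_N$ be (random) positive definite $m\times m$ matrices with $W_N\overset{p}{\to}W_0\succ0$, and assume the restricted eigenvalue condition: there is $\kappa>0$ such that for all $S\subseteq[d]$ with $|S|=s^*$ and all $\Delta\ne0$ with $\|\Delta_{S^c}\|_1\le3\|\Delta_S\|_1$, $$\kappa\le\frac{(\operatorname{Cov}(\tilde I,\tilde X)\Delta)^\top W_0\,(\operatorname{Cov}(\tilde I,\tilde X)\Delta)}{\|\Delta\|_2^2}.$$ Let $\lambda_N>0$ with $\lambda_N\asymp N^{-1/2}$, let $\hat\beta^{L}$ be a (measurable) minimizer over $\mathbb R^d$ of $\frac12\|W_N^{1/2}\hat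 g_N(\beta)\|_2^2+\lambda_N\|\beta\|_1$, let $c>0$ satisfy $|\beta^*_j|\ge c$ for all $j\in S^*$ (beta-min), and put $\widehat S=\{j:|\hat\beta^{L}_j|\ge c/2\}$. Let $W'_N$ be a second sequence of (random) positive definite matrices with $W'_N\overset{p}{\to}W'_0\succ0$, and let $\hat\beta$ be a (measurable) minimizer of $\hat g_N(\beta)^\top W'_N\hat g_N(\beta)$ over all $\beta\in\mathbb R^d$ with $\beta_{\widehat S^c}=0$. For a matrix $C\in\mathbb R^{m\times d}$, $W,O\in\mathbb R^{m\times m}$ and $S\subseteq[d]$ let $$V_S(C,W,O)=(C_S^\top WC_S)^{-1}\,(C_S^\top WOWC_S)\,(C_S^\top WC_S)^{-1},$$ where $C_S$ consists of the columns of $C$ in $S$, and let $V_{S^*}=V_{S^*}(\operatorname{Cov}(I,X),W'_0,\Omega)$. Then: 1. $\sqrt N(\hat\beta-\beta^*)\overset{d}{\to}\mathcal N(0,\tilde V)$, where $\tilde V\in\mathbb R^{d\times d}$ has the $S^*\times S^*$ block $V_{S^*}$ and is zero elsewhere. 2. Wald intervals are asymptotically valid: let $\widehat V\in\mathbb R^{d\times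 d}$ have the $\widehat S\times\widehat S$ block $V_{\widehat S}(\widehat{\operatorname{Cov}}(\tilde I,\tilde X),W'_N,\widehat\Omega)$ and be zero elsewhere, where $\widehat\Omega=\frac Nn\widehat\Omega_m+\frac N{\tilde n}\widehat\Omega_c$ and $\widehat\Omega_m,\widehat\Omega_c$ are the empirical covariance matrices of the (centred) products $I_iY_i$, $i\le n$, and $\tilde I_j\tilde X_j^\top\hat\beta$, $j\le\tilde n$. Then for every $\alpha\in(0,1)$ and every $j$ with $\tilde V_{jj}>0$, $$\mathbb P\Big(\beta^*_j\in\Big[\hat\beta_j-z_{1-\alpha/2}\sqrt{\widehat V_{jj}/N},\ \hat\beta_j+z_{1-\alpha/2}\sqrt{\widehat V_{jj}/N}\Big]\Big)\to1-\alpha,$$ where $z_{1-\alpha/2}$ is the $(1-\alpha/2)$-quantile of $\mathcal N(0,1)$. -/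

import Mathlib

open MeasureTheory ProbabilityTheory Filter Topology Matrix

namespace UnpairedIV

noncomputable section

/-! ### Population quantities -/

/-- The cross-covariance matrix `Cov(A, B)` of two random vectors. -/
def crossCov {Ω : Type*} [MeasurableSpace Ω] (P : Measure Ω) {p q : ℕ}
    (A : Ω → Fin p → ℝ) (B : Ω → Fin q → ℝ) : Matrix (Fin p) (Fin q) ℝ :=
  Matrix.of fun i j => cov[fun ω => A ω i, fun ω => B ω j; P]

/-- The product `(b - E b) (A - E A)` of a centred random scalar and a centred random vector;
for mean-zero variables this is `A b`. -/
def centeredProduct {Ω : Type*} [MeasurableSpace Ω] (P : Measure Ω) {p : ℕ}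
    (A : Ω → Fin p → ℝ) (b : Ω → ℝ) : Ω → Fin p → ℝ :=
  fun ω i => (b ω - ∫ ω', b ω' ∂P) * (A ω i - ∫ ω', A ω' i ∂P)

/-- The moment variance `Ω = τ⁻¹ Var(I Y) + τt⁻¹ Var(It Xtᵀ β)` (centred variables), the limit of
the variance of `√N ĝ_N(β)`. -/
def momentVar {Ω : Type*} [MeasurableSpace Ω] (P : Measure Ω) {m d : ℕ} (τ τt : ℝ)
    (I : Ω → Fin m → ℝ) (Y : Ω → ℝ) (It : Ω → Fin m → ℝ) (Xt : Ω → Fin d → ℝ)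
    (β : Fin d → ℝ) : Matrix (Fin m) (Fin m) ℝ :=
  τ⁻¹ • crossCov P (centeredProduct P I Y) (centeredProduct P I Y) +
    τt⁻¹ • crossCov P (centeredProduct P It fun ω => Xt ω ⬝ᵥ β)
      (centeredProduct P It fun ω => Xt ω ⬝ᵥ β)

/-- The support of a coefficient vector. -/
def supp {d : ℕ} (β : Fin d → ℝ) : Finset (Fin d) :=
  Finset.univ.filter fun j => β j ≠ 0

/-- The restricted eigenvalue condition at sparsity `s`: a uniform `κ > 0` bounds from below the
ratio `‖C Δ‖²_W / ‖Δ‖₂²`, where `‖a‖²_W = aᵀ W a`, over all nonzero `Δ` in the cone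
`‖Δ_{Sᶜ}‖₁ ≤ 3 ‖Δ_S‖₁`, for every `S` with `|S| = s`. -/
def RestrictedEigenvalue {m d : ℕ} (C : Matrix (Fin m) (Fin d) ℝ) (W : Matrix (Fin m) (Fin m) ℝ)
    (s : ℕ) : Prop :=
  ∃ κ : ℝ, 0 < κ ∧ ∀ S : Finset (Fin d), S.card = s → ∀ Δ : Fin d → ℝ, Δ ≠ 0 →
    ∑ j ∈ Sᶜ, |Δ j| ≤ 3 * ∑ j ∈ S, |Δ j| →
      κ ≤ ((C *ᵥ Δ) ⬝ᵥ (W *ᵥ (C *ᵥ Δ))) / ∑ j, Δ j ^ 2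

/-- The columns of `C` with index in `S`. -/
def cols {m d : ℕ} (C : Matrix (Fin m) (Fin d) ℝ) (S : Finset (Fin d)) :
    Matrix (Fin m) S ℝ :=
  C.submatrix id Subtype.val

/-- The sandwich covariance `(C_Sᵀ W C_S)⁻¹ (C_Sᵀ W O W C_S) (C_Sᵀ W C_S)⁻¹`. -/
def sandwich {m d : ℕ} (C : Matrix (Fin m) (Fin d) ℝ) (W O : Matrix (Fin m) (Fin m) ℝ)
    (S : Finset (Fin d)) : Matrix S S ℝ :=
  ((cols C S)ᵀ * W * cols C S)⁻¹ * ((cols C S)ᵀ * W * O * W * cols C S) *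
    ((cols C S)ᵀ * W * cols C S)⁻¹

/-- The `d × d` matrix whose `S × S` block is `V` and which is zero elsewhere. -/
def embedBlock {d : ℕ} (S : Finset (Fin d)) (V : Matrix S S ℝ) : Matrix (Fin d) (Fin d) ℝ :=
  Matrix.of fun i j => if h : i ∈ S ∧ j ∈ S then V ⟨i, h.1⟩ ⟨j, h.2⟩ else 0

/-! ### Sample quantities (functions of the realized data) -/

/-- How the data are centred: `population` means that the variables have population mean zero and
are used as they are, `sample` that the sample mean is subtracted. -/
inductive Centering
  | population
  | sample

/-- The average of the first `n` terms. -/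
def avg {E : Type*} [AddCommGroup E] [Module ℝ E] (n : ℕ) (v : ℕ → E) : E :=
  (n : ℝ)⁻¹ • ∑ i ∈ Finset.range n, v i

/-- The vector that the centring convention subtracts from the first `n` data points. -/
def Centering.shift {E : Type*} [AddCommGroup E] [Module ℝ E] (c : Centering) (n : ℕ)
    (v : ℕ → E) : E :=
  match c with
  | .population => 0
  | .sample => avg n v

/-- The summands `A_i b_i` of the sample covariances, for data centred by the convention `c`. -/
def sampleProduct {p : ℕ} (c : Centering) (n : ℕ) (A : ℕ → Fin p → ℝ) (b : ℕ → ℝ) :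
    ℕ → Fin p → ℝ :=
  fun i => (b i - c.shift n b) • (A i - c.shift n A)

/-- The sample covariance `n⁻¹ ∑ A_i b_i` of a vector and a scalar. -/
def sampleCovVec {p : ℕ} (c : Centering) (n : ℕ) (A : ℕ → Fin p → ℝ) (b : ℕ → ℝ) : Fin p → ℝ :=
  avg n (sampleProduct c n A b)

/-- The sample cross-covariance `n⁻¹ ∑ A_i B_iᵀ`. -/
def sampleCovMat {p q : ℕ} (c : Centering) (n : ℕ) (A : ℕ → Fin p → ℝ) (B : ℕ → Fin q → ℝ) :
    Matrix (Fin p) (Fin q) ℝ :=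
  Matrix.of fun i j => sampleCovVec c n A (fun k => B k j) i

/-- The empirical covariance matrix `n⁻¹ ∑ (z_i - z̄)(z_i - z̄)ᵀ`. -/
def sampleVar {p : ℕ} (n : ℕ) (z : ℕ → Fin p → ℝ) : Matrix (Fin p) (Fin p) ℝ :=
  avg n fun i => Matrix.vecMulVec (z i - avg n z) (z i - avg n z)

/-- The sample version of `momentVar`, with `τ, τt` replaced by `n / N, nt / N`, `N = n + nt`. -/
def sampleMomentVar {m d : ℕ} (c : Centering) (n nt : ℕ) (I : ℕ → Fin m → ℝ) (Y : ℕ → ℝ)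
    (It : ℕ → Fin m → ℝ) (Xt : ℕ → Fin d → ℝ) (b : Fin d → ℝ) : Matrix (Fin m) (Fin m) ℝ :=
  ((n : ℝ) / ((n + nt : ℕ) : ℝ))⁻¹ • sampleVar n (sampleProduct c n I Y) +
    ((nt : ℝ) / ((n + nt : ℕ) : ℝ))⁻¹ •
      sampleVar nt (sampleProduct c nt It fun j => Xt j ⬝ᵥ b)

/-! ### Estimators -/

/-- The GMM criterion `ĝ(β)ᵀ W ĝ(β) = ‖W^{1/2} ĝ(β)‖₂²` with `ĝ(β) = a - B β`. -/
def gmmObjective {m d : ℕ} (W : Matrix (Fin m) (Fin m) ℝ) (a : Fin m → ℝ)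
    (B : Matrix (Fin m) (Fin d) ℝ) (β : Fin d → ℝ) : ℝ :=
  (a - B *ᵥ β) ⬝ᵥ (W *ᵥ (a - B *ᵥ β))

/-- `b` minimizes the `ℓ¹`-penalized criterion `½ ‖W^{1/2} ĝ(β)‖₂² + lam ‖β‖₁` over `ℝ^d`. -/
def IsLassoGMM {m d : ℕ} (W : Matrix (Fin m) (Fin m) ℝ) (a : Fin m → ℝ)
    (B : Matrix (Fin m) (Fin d) ℝ) (lam : ℝ) (b : Fin d → ℝ) : Prop :=
  ∀ β : Fin d → ℝ, 1 / 2 * gmmObjective W a B b + lam * ∑ j, |b j| ≤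
    1 / 2 * gmmObjective W a B β + lam * ∑ j, |β j|

/-- The selected support `{j : |b_j| ≥ c / 2}`. -/
def selected {d : ℕ} (c : ℝ) (b : Fin d → ℝ) : Finset (Fin d) :=
  Finset.univ.filter fun j => c / 2 ≤ |b j|

/-- `b` minimizes the GMM criterion over all `β` that vanish off `S`. -/
def IsRefitGMM {m d : ℕ} (W : Matrix (Fin m) (Fin m) ℝ) (a : Fin m → ℝ)
    (B : Matrix (Fin m) (Fin d) ℝ) (S : Finset (Fin d)) (b : Fin d → ℝ) : Prop :=
  (∀ j, j ∉ S → b j = 0) ∧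
    ∀ β : Fin d → ℝ, (∀ j, j ∉ S → β j = 0) → gmmObjective W a B b ≤ gmmObjective W a B β

/-- The Wald interval `[b_j - z √(V_jj / N), b_j + z √(V_jj / N)]` for the `j`-th coefficient. -/
def waldInterval {d : ℕ} (z : ℝ) (N : ℕ) (b : Fin d → ℝ) (V : Matrix (Fin d) (Fin d) ℝ)
    (j : Fin d) : Set ℝ :=
  Set.Icc (b j - z * √(V j j / (N : ℝ))) (b j + z * √(V j j / (N : ℝ)))

end

end UnpairedIV

/-
At the true parameter the sample moments satisfy `√N ĝ_N(β) → N(0, Ω)`: the two samples are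
independent, exogeneity makes the limiting mean vanish, and estimating the means changes `ĝ_N(β)`
only by a product of two errors of order `N^{-1/2}`. A penalty of order `N^{-1/2}` dominates
`ĝ_N(β)ᵀ W_N ĝ_N(β)`, which is of order `N⁻¹`, so every cluster point of the Lasso solves the
population moment equation without exceeding `β` in `ℓ¹` norm, and the restricted eigenvalue
condition leaves only `β`. The selected support is therefore `supp β` with probability tending to
one, and on that event the first-order condition makes the refit error a linear image of `ĝ_N(β)`,
with a matrix that converges in probability. Slutsky's theorem gives the normal limit and, with the
consistency of the plug-in variance, the coverage.
-/

namespace UnpairedIV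

section ConvergenceInProbability

variable {Ω ι : Type*} [MeasurableSpace Ω] {P : Measure Ω} {l : Filter ι}

/-- The filter of the families of events `A ⊆ ι × Ω` whose sections have probability tending to
one along `l`. Convergence in probability to a constant is convergence along this filter, so the
deterministic calculus of limits, with no measurability side conditions, applies to it. -/
def probFilter (l : Filter ι) (P : Measure Ω) : Filter (ι × Ω) where
  sets := {A | Tendsto (fun k => P {ω | (k, ω) ∉ A}) l (𝓝 0)}
  univ_sets := by simp [tendsto_const_nhds]
  sets_of_superset {A B} hA hAB :=
    tendsto_of_tendsto_of_tendsto_of_le_of_le tendsto_const_nhds hA (fun _ => zero_le)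
      fun _ => measure_mono fun _ hω h => hω (hAB h)
  inter_sets {A B} hA hB := by
    have h : Tendsto (fun k => P {ω | (k, ω) ∉ A} + P {ω | (k, ω) ∉ B}) l (𝓝 0) := by
      simpa only [add_zero] using Tendsto.add hA hB
    refine tendsto_of_tendsto_of_tendsto_of_le_of_le tendsto_const_nhds h (fun _ => zero_le)
      fun k => (measure_mono fun ω hω => ?_).trans (measure_union_le _ _)
    exact not_and_or.1 hω

lemma eventually_probFilter {p : ι × Ω → Prop} :
    (∀ᶠ x in probFilter l P, p x) ↔ Tendsto (fun k => P {ω | ¬ p (k, ω)}) l (𝓝 0) :=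
  Iff.rfl

lemma eventually_probFilter_of_ae {p : ι → Ω → Prop} (h : ∀ k, ∀ᵐ ω ∂P, p k ω) :
    ∀ᶠ x in probFilter l P, p x.1 x.2 := by
  rw [eventually_probFilter]
  simp_rw [fun k => ae_iff.1 (h k)]
  exact tendsto_const_nhds

lemma tendsto_fst_probFilter : Tendsto Prod.fst (probFilter l P) l := by
  intro s hs
  refine tendsto_const_nhds.congr' ?_
  filter_upwards [hs] with k hk
  simp [hk]

lemma tendsto_probFilter_iff_tendstoInMeasure {E : Type*} [PseudoMetricSpace E] {f : ι → Ω → E}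
    {a : E} :
    Tendsto (fun x : ι × Ω => f x.1 x.2) (probFilter l P) (𝓝 a) ↔
      TendstoInMeasure P f l fun _ => a := by
  rw [tendstoInMeasure_iff_dist, Metric.tendsto_nhds]
  simp_rw [eventually_probFilter, not_lt]

lemma tendsto_matrix_probFilter {p q : ℕ} {M : ι → Ω → Matrix (Fin p) (Fin q) ℝ}
    {M₀ : Matrix (Fin p) (Fin q) ℝ}
    (h : ∀ i j, TendstoInMeasure P (fun k ω => M k ω i j) l fun _ => M₀ i j) :
    Tendsto (fun x : ι × Ω => M x.1 x.2) (probFilter l P) (𝓝 M₀) :=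
  tendsto_pi_nhds.2 fun i => tendsto_pi_nhds.2 fun j =>
    tendsto_probFilter_iff_tendstoInMeasure (f := fun k ω => M k ω i j) |>.2 (h i j)

/-- Boundedness in probability (tightness of the norms), `f = O_P(1)`. -/
def BddInProb {E : Type*} [Norm E] (l : Filter ι) (P : Measure Ω) (f : ι → Ω → E) : Prop :=
  ∀ ε : ENNReal, 0 < ε → ∃ K : ℝ, 0 < K ∧ ∀ᶠ k in l, P {ω | K ≤ ‖f k ω‖} ≤ ε

lemma BddInProb.tendsto_norm_mul_norm {E F : Type*} [SeminormedAddGroup E] [SeminormedAddGroup F]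
    {f : ι → Ω → E} {h : ι × Ω → F} (hf : BddInProb l P f)
    (hh : Tendsto h (probFilter l P) (𝓝 0)) :
    Tendsto (fun x : ι × Ω => ‖f x.1 x.2‖ * ‖h x‖) (probFilter l P) (𝓝 0) := by
  rw [Metric.tendsto_nhds]
  intro δ hδ
  rw [eventually_probFilter, ENNReal.tendsto_nhds_zero]
  intro ε hε
  obtain ⟨K, hK, hfK⟩ := hf (ε / 2) (ENNReal.half_pos hε.ne')
  have hsmall := Metric.tendsto_nhds.1 hh (δ / K) (by positivity)
  rw [eventually_probFilter, ENNReal.tendsto_nhds_zero] at hsmall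
  filter_upwards [hfK, hsmall (ε / 2) (ENNReal.half_pos hε.ne')] with k hk₁ hk₂
  have hsub : {ω | ¬ dist (‖f k ω‖ * ‖h (k, ω)‖) 0 < δ} ⊆
      {ω | K ≤ ‖f k ω‖} ∪ {ω | ¬ dist (h (k, ω)) 0 < δ / K} := by
    intro ω hω
    contrapose! hω
    simp only [Set.mem_union, Set.mem_ofPred_eq, not_or, not_le, dist_zero_right,
      Real.norm_eq_abs, abs_mul, abs_norm] at hω ⊢
    calc ‖f k ω‖ * ‖h (k, ω)‖ ≤ K * ‖h (k, ω)‖ := by gcongr; exact hω.1.le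
      _ < K * (δ / K) := by gcongr; exact hω.2
      _ = δ := mul_div_cancel₀ δ hK.ne'
  calc P {ω | ¬ dist (‖f k ω‖ * ‖h (k, ω)‖) 0 < δ}
      ≤ P {ω | K ≤ ‖f k ω‖} + P {ω | ¬ dist (h (k, ω)) 0 < δ / K} :=
        (measure_mono hsub).trans (measure_union_le _ _)
    _ ≤ ε / 2 + ε / 2 := add_le_add hk₁ hk₂
    _ = ε := ENNReal.add_halves ε

end ConvergenceInProbability

section Slutsky

variable {Ω Ω' ι : Type*} [MeasurableSpace Ω] [MeasurableSpace Ω'] {P : Measure Ω}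
  [IsProbabilityMeasure P] {P' : Measure Ω'} [IsProbabilityMeasure P'] {l : Filter ι}
  {E : Type*} [NormedAddCommGroup E] [MeasurableSpace E] [BorelSpace E]
  {X : ι → Ω → E} {Z : Ω' → E}

lemma bddInProb_of_tendstoInDistribution
    (hX : TendstoInDistribution X l Z (fun _ => P) P') : BddInProb l P X := by
  have hnorm := hX.continuous_comp continuous_norm
  intro ε hε
  have := Measure.isProbabilityMeasure_map hnorm.aemeasurable_limit
  have htight := tendsto_measure_norm_gt_of_isTightMeasureSet
    (isTightMeasureSet_singleton (μ := P'.map (norm ∘ Z)))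
  simp only [Set.mem_singleton_iff, iSup_iSup_eq_left] at htight
  obtain ⟨K, hK, hK0⟩ := ((htight.eventually_lt_const hε).and (eventually_gt_atTop 0)).exists
  refine ⟨K + 1, by positivity, ?_⟩
  have hlim := ProbabilityMeasure.limsup_measure_closed_le_of_tendsto hnorm.tendsto
    (isClosed_Ici (a := K + 1))
  have hlt : limsup (fun k => P.map (norm ∘ X k) (Set.Ici (K + 1))) l < ε := by
    refine (hlim.trans (measure_mono fun x hx => ?_)).trans_lt hK
    exact (lt_add_one K).trans_le ((Set.mem_Ici.1 hx).trans (le_abs_self x))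
  filter_upwards [eventually_lt_of_limsup_lt hlt] with k hk
  rw [Measure.map_apply_of_aemeasurable (hnorm.forall_aemeasurable k) measurableSet_Ici] at hk
  exact hk.le

lemma tendsto_probFilter_zero_of_tendstoInDistribution_smul [NormedSpace ℝ E] {r : ι → ℝ}
    (hr : Tendsto r l atTop)
    (hX : TendstoInDistribution (fun k ω => r k • X k ω) l Z (fun _ => P) P') :
    Tendsto (fun x : ι × Ω => X x.1 x.2) (probFilter l P) (𝓝 0) := by
  have hr' := hr.comp (tendsto_fst_probFilter (P := P))
  rw [tendsto_zero_iff_norm_tendsto_zero]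
  refine ((bddInProb_of_tendstoInDistribution hX).tendsto_norm_mul_norm
    (tendsto_inv_atTop_zero.comp hr')).congr' ?_
  filter_upwards [hr'.eventually_gt_atTop 0] with x hx
  simp only [Function.comp_apply, norm_smul, norm_inv] at hx ⊢
  rw [mul_comm, inv_mul_cancel_left₀ (norm_ne_zero_iff.2 hx.ne')]

/-- The error `(L - L₀) X` is negligible because `X` is bounded in probability. -/
lemma tendstoInDistribution_of_eventually_eq_apply {F : Type*} [NormedAddCommGroup F]
    [NormedSpace ℝ E] [NormedSpace ℝ F] [SecondCountableTopology F] [MeasurableSpace F]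
    [BorelSpace F] [l.IsCountablyGenerated] {L : ι × Ω → E →L[ℝ] F} {L₀ : E →L[ℝ] F}
    {Y : ι → Ω → F} (hX : TendstoInDistribution X l Z (fun _ => P) P')
    (hL : Tendsto L (probFilter l P) (𝓝 L₀)) (hY : ∀ k, AEMeasurable (Y k) P)
    (hYL : ∀ᶠ x in probFilter l P, Y x.1 x.2 = L x (X x.1 x.2)) :
    TendstoInDistribution Y l (L₀ ∘ Z) (fun _ => P) P' := by
  refine tendstoInDistribution_of_tendstoInMeasure_sub Y (L₀ ∘ Z)
    (hX.continuous_comp L₀.continuous) (tendsto_probFilter_iff_tendstoInMeasure.1 ?_) hY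
  refine squeeze_zero_norm' ?_ ((bddInProb_of_tendstoInDistribution hX).tendsto_norm_mul_norm
    (tendsto_sub_nhds_zero_iff.2 hL))
  filter_upwards [hYL] with x hx
  calc ‖(Y - fun k => L₀ ∘ X k) x.1 x.2‖ = ‖(L x - L₀) (X x.1 x.2)‖ := by
        simp [hx]
    _ ≤ ‖X x.1 x.2‖ * ‖L x - L₀‖ := mul_comm ‖L x - L₀‖ _ ▸ (L x - L₀).le_opNorm _

end Slutsky

section Lasso

variable {m d : ℕ} {C B : Matrix (Fin m) (Fin d) ℝ} {W W₀ : Matrix (Fin m) (Fin m) ℝ}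
  {a : Fin m → ℝ} {β y b : Fin d → ℝ} {lam : ℝ}

lemma apply_eq_zero_of_notMem_supp {j : Fin d} (hj : j ∉ supp β) : β j = 0 := by
  simpa [supp] using hj

lemma sum_abs_compl_supp_le (h : ∑ j, |y j| ≤ ∑ j, |β j|) :
    ∑ j ∈ (supp β)ᶜ, |(y - β) j| ≤ ∑ j ∈ supp β, |(y - β) j| := by
  have hβ : ∀ j ∈ (supp β)ᶜ, β j = 0 := fun j hj =>
    apply_eq_zero_of_notMem_supp (Finset.mem_compl.1 hj)
  rw [← Finset.sum_add_sum_compl (supp β), ← Finset.sum_add_sum_compl (supp β) fun j => |β j|,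
    Finset.sum_eq_zero (s := (supp β)ᶜ) (f := fun j => |β j|) fun j hj => by rw [hβ j hj, abs_zero],
    add_zero] at h
  have hoff : ∑ j ∈ (supp β)ᶜ, |(y - β) j| = ∑ j ∈ (supp β)ᶜ, |y j| :=
    Finset.sum_congr rfl fun j hj => by rw [Pi.sub_apply, hβ j hj, sub_zero]
  have hon : ∑ j ∈ supp β, |β j| - ∑ j ∈ supp β, |y j| ≤ ∑ j ∈ supp β, |(y - β) j| := by
    rw [← Finset.sum_sub_distrib]
    refine Finset.sum_le_sum fun j _ => ?_
    rw [Pi.sub_apply, abs_sub_comm]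
    exact abs_sub_abs_le_abs_sub _ _
  linarith

lemma RestrictedEigenvalue.eq_of_sum_abs_le (hRE : RestrictedEigenvalue C W (supp β).card)
    (h : ∑ j, |y j| ≤ ∑ j, |β j|) (hy : gmmObjective W (C *ᵥ β) C y ≤ 0) : y = β := by
  obtain ⟨κ, hκ, hRE⟩ := hRE
  by_contra hne
  have hcone : ∑ j ∈ (supp β)ᶜ, |(y - β) j| ≤ 3 * ∑ j ∈ supp β, |(y - β) j| := by
    linarith [sum_abs_compl_supp_le h,
      Finset.sum_nonneg fun j (_ : j ∈ supp β) => abs_nonneg ((y - β) j)]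
  rw [gmmObjective, ← mulVec_sub, ← neg_sub y β, mulVec_neg, mulVec_neg, neg_dotProduct_neg] at hy
  exact (hRE _ rfl _ (sub_ne_zero.2 hne) hcone).not_gt
    ((div_nonpos_of_nonpos_of_nonneg hy (by positivity)).trans_lt hκ)

lemma gmmObjective_nonneg (hW : W.PosSemidef) : 0 ≤ gmmObjective W a B b := by
  simpa only [gmmObjective, star_trivial] using hW.dotProduct_mulVec_nonneg (a - B *ᵥ b)

lemma IsLassoGMM.sum_abs_le (hb : IsLassoGMM W a B lam b) (hW : W.PosSemidef) (hlam : 0 < lam) :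
    ∑ j, |b j| ≤ ∑ j, |β j| + lam⁻¹ * gmmObjective W a B β / 2 := by
  refine le_of_mul_le_mul_left ?_ hlam
  have hcancel : lam * (lam⁻¹ * gmmObjective W a B β / 2) = gmmObjective W a B β / 2 := by
    field_simp
  rw [mul_add, hcancel]
  linarith [hb β, gmmObjective_nonneg (a := a) (B := B) (b := b) hW]

lemma IsLassoGMM.gmmObjective_le (hb : IsLassoGMM W a B lam b) (hlam : 0 ≤ lam) :
    gmmObjective W a B b ≤ gmmObjective W a B β + 2 * lam * ∑ j, |β j| := by
  have : 0 ≤ lam * ∑ j, |b j| := by positivity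
  linarith [hb β]

lemma continuous_gmmObjective :
    Continuous fun p : Matrix (Fin m) (Fin m) ℝ × (Fin m → ℝ) × Matrix (Fin m) (Fin d) ℝ ×
      (Fin d → ℝ) => gmmObjective p.1 p.2.1 p.2.2.1 p.2.2.2 := by
  unfold gmmObjective
  fun_prop

section Limits

variable {α : Type*} {l : Filter α} {W : α → Matrix (Fin m) (Fin m) ℝ} {a : α → Fin m → ℝ}
  {B : α → Matrix (Fin m) (Fin d) ℝ} {b : α → Fin d → ℝ}

/-- By compactness it suffices that `β` is the only cluster point, and every cluster point `y`
satisfies `‖y‖₁ ≤ ‖β‖₁` and has criterion `0` in the limit. -/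
lemma RestrictedEigenvalue.tendsto_of_eventually_le
    (hRE : RestrictedEigenvalue C W₀ (supp β).card) {r q : α → ℝ} (hW : Tendsto W l (𝓝 W₀))
    (ha : Tendsto a l (𝓝 (C *ᵥ β))) (hB : Tendsto B l (𝓝 C)) (hr : Tendsto r l (𝓝 0))
    (hq : Tendsto q l (𝓝 0)) (hbr : ∀ᶠ x in l, ∑ j, |b x j| ≤ ∑ j, |β j| + r x)
    (hbq : ∀ᶠ x in l, gmmObjective (W x) (a x) (B x) (b x) ≤ q x) : Tendsto b l (𝓝 β) := by
  refine (isCompact_closedBall (0 : Fin d → ℝ) (∑ j, |β j| + 1)).tendsto_nhds_of_unique_mapClusterPt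
    ?_ fun y _ hy => ?_
  · filter_upwards [hbr, hr.eventually_lt_const one_pos] with x hx hrx
    rw [mem_closedBall_zero_iff, pi_norm_le_iff_of_nonneg (by positivity)]
    intro j
    have := Finset.single_le_sum (fun j _ => abs_nonneg (b x j)) (Finset.mem_univ j)
    rw [Real.norm_eq_abs]
    linarith
  · obtain ⟨u, hul, hu⟩ := mapClusterPt_iff_ultrafilter.1 hy
    refine hRE.eq_of_sum_abs_le ?_ ?_
    · have hlim : Tendsto (fun x => ∑ j, |b x j|) u (𝓝 (∑ j, |y j|)) :=
        tendsto_finsetSum _ fun j _ => (tendsto_pi_nhds.1 hu j).abs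
      have hbound := (hr.mono_left hul).const_add (∑ j, |β j|)
      rw [add_zero] at hbound
      exact le_of_tendsto_of_tendsto hlim hbound (hbr.filter_mono hul)
    · have hlim := (continuous_gmmObjective.tendsto (W₀, C *ᵥ β, C, y)).comp
        ((hW.mono_left hul).prodMk_nhds
          ((ha.mono_left hul).prodMk_nhds ((hB.mono_left hul).prodMk_nhds hu)))
      exact le_of_tendsto_of_tendsto hlim (hq.mono_left hul) (hbq.filter_mono hul)

lemma tendsto_of_isLassoGMM (hRE : RestrictedEigenvalue C W₀ (supp β).card) {lam : α → ℝ}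
    (hlam : ∀ x, 0 < lam x) (hlam0 : Tendsto lam l (𝓝 0)) (hW : Tendsto W l (𝓝 W₀))
    (hWpos : ∀ᶠ x in l, (W x).PosSemidef) (hB : Tendsto B l (𝓝 C))
    (hg : Tendsto (fun x => (√(lam x))⁻¹ • (a x - B x *ᵥ β)) l (𝓝 0))
    (hb : ∀ᶠ x in l, IsLassoGMM (W x) (a x) (B x) (lam x) (b x)) : Tendsto b l (𝓝 β) := by
  have hmoment : Tendsto (fun x => a x - B x *ᵥ β) l (𝓝 0) := by
    have := hlam0.sqrt.smul hg
    rw [smul_zero] at this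
    exact this.congr fun x => smul_inv_smul₀ (Real.sqrt_pos.2 (hlam x)).ne' _
  have ha : Tendsto a l (𝓝 (C *ᵥ β)) := by
    have hmul : Continuous fun M : Matrix (Fin m) (Fin d) ℝ => M *ᵥ β := by fun_prop
    simpa using hmoment.add ((hmul.tendsto C).comp hB)
  have hQ : Tendsto (fun x => (lam x)⁻¹ * gmmObjective (W x) (a x) (B x) β) l (𝓝 0) := by
    have hquad : Continuous fun p : (Fin m → ℝ) × Matrix (Fin m) (Fin m) ℝ =>
        p.1 ⬝ᵥ (p.2 *ᵥ p.1) := by fun_prop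
    have := (hquad.tendsto (0, W₀)).comp (hg.prodMk_nhds hW)
    rw [zero_dotProduct] at this
    refine this.congr fun x => ?_
    simp only [Function.comp_apply, mulVec_smul, smul_dotProduct, dotProduct_smul, smul_eq_mul,
      gmmObjective]
    rw [← mul_assoc, ← mul_inv, Real.mul_self_sqrt (hlam x).le]
  refine hRE.tendsto_of_eventually_le hW ha hB
    (r := fun x => (lam x)⁻¹ * gmmObjective (W x) (a x) (B x) β / 2)
    (q := fun x => gmmObjective (W x) (a x) (B x) β + 2 * lam x * ∑ j, |β j|) ?_ ?_ ?_ ?_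
  · simpa using hQ.div_const 2
  · have := (hlam0.mul hQ).add ((hlam0.const_mul 2).mul_const (∑ j, |β j|))
    simpa [mul_inv_cancel_left₀ (hlam _).ne'] using this
  · filter_upwards [hWpos, hb] with x hx hbx using hbx.sum_abs_le hx (hlam x)
  · filter_upwards [hb] with x hbx using hbx.gmmObjective_le (hlam x).le

lemma eventually_selected_eq_supp {c : ℝ} (hc : 0 < c) (hmin : ∀ j ∈ supp β, c ≤ |β j|)
    (hb : Tendsto b l (𝓝 β)) : ∀ᶠ x in l, selected c (b x) = supp β := by
  filter_upwards [Metric.tendsto_nhds.1 hb (c / 2) (by positivity)] with x hx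
  ext j
  have hdist : |b x j - β j| < c / 2 := (dist_pi_lt_iff (by positivity)).1 hx j
  have habs := abs_lt.1 ((abs_abs_sub_abs_le_abs_sub (b x j) (β j)).trans_lt hdist)
  simp only [selected, Finset.mem_filter, Finset.mem_univ, true_and]
  constructor
  · intro hj
    by_contra hsupp
    rw [apply_eq_zero_of_notMem_supp hsupp, abs_zero] at habs
    linarith
  · intro hj
    linarith [hmin j hj]

end Limits

end Lasso

section Refit

variable {m d : ℕ} {W : Matrix (Fin m) (Fin m) ℝ} {S : Finset (Fin d)}

/-- The `d × S` matrix that extends a vector on `S` by zero: it turns the blocks `C_S` and the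
zero-padded covariance matrices into ordinary matrix products. -/
def inclMatrix (S : Finset (Fin d)) : Matrix (Fin d) S ℝ :=
  cols 1 S

lemma cols_eq_mul (C : Matrix (Fin m) (Fin d) ℝ) (S : Finset (Fin d)) :
    cols C S = C * inclMatrix S := by
  ext i j
  simp [inclMatrix, cols, mul_apply, one_apply]

lemma inclMatrix_mulVec (v : S → ℝ) (i : Fin d) :
    (inclMatrix S *ᵥ v) i = if h : i ∈ S then v ⟨i, h⟩ else 0 := by
  simp only [inclMatrix, cols, mulVec, dotProduct, submatrix_apply, id_eq, one_apply, ite_mul,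
    one_mul, zero_mul]
  split_ifs with h
  · exact (Finset.sum_eq_single_of_mem ⟨i, h⟩ (Finset.mem_univ _)
      fun k _ hk => if_neg fun hik => hk (Subtype.ext hik.symm)).trans (if_pos rfl)
  · exact Finset.sum_eq_zero fun k _ => if_neg fun hik : i = k => h (hik ▸ k.2)

lemma inclMatrix_mulVec_restrict {b : Fin d → ℝ} (hb : ∀ j, j ∉ S → b j = 0) :
    inclMatrix S *ᵥ (fun j => b j) = b := by
  ext i
  rw [inclMatrix_mulVec]
  split_ifs with h
  · rfl
  · exact (hb i h).symm

lemma embedBlock_eq_mul (V : Matrix S S ℝ) :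
    embedBlock S V = inclMatrix S * V * (inclMatrix S)ᵀ := by
  have hleft : ∀ {p : Type} (M : Matrix S p ℝ) i j,
      (inclMatrix S * M) i j = if h : i ∈ S then M ⟨i, h⟩ j else 0 := fun M i j =>
    inclMatrix_mulVec (fun k => M k j) i
  ext i j
  rw [← transpose_apply (inclMatrix S * V * (inclMatrix S)ᵀ), transpose_mul, transpose_transpose,
    hleft, embedBlock, of_apply]
  by_cases hj : j ∈ S <;> by_cases hi : i ∈ S <;> simp [hi, hj, hleft]

/-- The matrix `(C_Sᵀ W C_S)⁻¹ C_Sᵀ W`, padded with zero rows off `S`: it takes the sample moments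
at the true parameter to the estimation error of the estimator refitted on `S`. -/
noncomputable def gain (C : Matrix (Fin m) (Fin d) ℝ) (W : Matrix (Fin m) (Fin m) ℝ)
    (S : Finset (Fin d)) : Matrix (Fin d) (Fin m) ℝ :=
  inclMatrix S * (((cols C S)ᵀ * W * cols C S)⁻¹ * ((cols C S)ᵀ * W))

lemma embedBlock_sandwich (C : Matrix (Fin m) (Fin d) ℝ) (hW : W.IsSymm)
    (O : Matrix (Fin m) (Fin m) ℝ) :
    embedBlock S (sandwich C W O S) = gain C W S * O * (gain C W S)ᵀ := by
  simp only [embedBlock_eq_mul, sandwich, gain, transpose_mul, transpose_nonsing_inv,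
    transpose_transpose, hW.eq, Matrix.mul_assoc]

lemma IsRefitGMM.dotProduct_mulVec_eq_zero {a : Fin m → ℝ} {B : Matrix (Fin m) (Fin d) ℝ}
    {b h : Fin d → ℝ} (hb : IsRefitGMM W a B S b) (hW : W.IsSymm) (hh : ∀ j, j ∉ S → h j = 0) :
    (B *ᵥ h) ⬝ᵥ (W *ᵥ (a - B *ᵥ b)) = 0 := by
  set e := a - B *ᵥ b with he
  set u := B *ᵥ h
  have hsymm : e ⬝ᵥ (W *ᵥ u) = u ⬝ᵥ (W *ᵥ e) := by
    rw [dotProduct_mulVec, ← mulVec_transpose, hW.eq, dotProduct_comm]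
  have hquad : ∀ t : ℝ, 0 ≤ (u ⬝ᵥ (W *ᵥ u)) * (t * t) + (-2 * (u ⬝ᵥ (W *ᵥ e))) * t + 0 := by
    intro t
    have hmin := hb.2 (b + t • h) fun j hj => by simp [hb.1 j hj, hh j hj]
    have hres : a - B *ᵥ (b + t • h) = e - t • u := by
      rw [mulVec_add, mulVec_smul, he, sub_sub]
    clear_value e
    rw [gmmObjective, gmmObjective, hres, ← he, mulVec_sub, mulVec_smul, sub_dotProduct,
      dotProduct_sub, dotProduct_sub, smul_dotProduct, smul_dotProduct, dotProduct_smul,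
      dotProduct_smul, hsymm] at hmin
    simp only [smul_eq_mul] at hmin
    linarith
  have hdiscrim := discrim_le_zero hquad
  simp only [discrim, mul_zero, sub_zero] at hdiscrim
  nlinarith [sq_nonneg (u ⬝ᵥ (W *ᵥ e))]

lemma IsRefitGMM.sub_eq_gain_mulVec {a : Fin m → ℝ} {B : Matrix (Fin m) (Fin d) ℝ}
    {b β : Fin d → ℝ} (hb : IsRefitGMM W a B S b) (hW : W.IsSymm) (hβ : ∀ j, j ∉ S → β j = 0)
    (hdet : ((cols B S)ᵀ * W * cols B S).det ≠ 0) :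
    b - β = gain B W S *ᵥ (a - B *ᵥ β) := by
  have hfoc : ((cols B S)ᵀ * W) *ᵥ (a - B *ᵥ b) = 0 := by
    ext j
    have hj := hb.dotProduct_mulVec_eq_zero hW (h := inclMatrix S *ᵥ Pi.single j 1)
      fun i hi => by rw [inclMatrix_mulVec, dif_neg hi]
    rw [mulVec_mulVec, ← cols_eq_mul, mulVec_single_one] at hj
    rwa [← mulVec_mulVec]
  have herr := inclMatrix_mulVec_restrict (S := S) (b := b - β) fun j hj => by
    simp [hb.1 j hj, hβ j hj]
  set v : S → ℝ := fun j => (b - β) j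
  have hmoment : a - B *ᵥ β = (a - B *ᵥ b) + cols B S *ᵥ v := by
    rw [cols_eq_mul, ← mulVec_mulVec, herr, mulVec_sub, sub_add_sub_cancel]
  rw [gain, hmoment, ← mulVec_mulVec, ← mulVec_mulVec, mulVec_add, hfoc, zero_add, mulVec_mulVec v,
    mulVec_mulVec v, nonsing_inv_mul _ (isUnit_iff_ne_zero.2 hdet), one_mulVec, herr]

lemma RestrictedEigenvalue.det_gram_ne_zero {C : Matrix (Fin m) (Fin d) ℝ}
    {W₀ : Matrix (Fin m) (Fin m) ℝ} (hRE : RestrictedEigenvalue C W₀ S.card) (hW : W.PosDef) :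
    ((cols C S)ᵀ * W * cols C S).det ≠ 0 := by
  have hinj : Function.Injective (cols C S).mulVec := by
    rw [← coe_mulVecLin, ← LinearMap.ker_eq_bot, LinearMap.ker_eq_bot']
    intro v hv
    obtain ⟨κ, hκ, hRE⟩ := hRE
    by_contra hne
    have hpad : inclMatrix S *ᵥ v ≠ 0 := fun h0 => hne <| funext fun j => by
      simpa [inclMatrix_mulVec] using congrFun h0 j
    have hle := hRE S rfl _ hpad (by
      rw [Finset.sum_eq_zero fun j hj => by
        rw [inclMatrix_mulVec, dif_neg (Finset.mem_compl.1 hj), abs_zero]]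
      positivity)
    rw [mulVecLin_apply, cols_eq_mul, ← mulVec_mulVec] at hv
    rw [hv, zero_dotProduct, zero_div] at hle
    exact hle.not_gt hκ
  rw [← conjTranspose_eq_transpose_of_trivial]
  exact (hW.conjTranspose_mul_mul_same hinj).det_pos.ne'

section Limits

variable {α : Type*} {l : Filter α} {C : Matrix (Fin m) (Fin d) ℝ}
  {B : α → Matrix (Fin m) (Fin d) ℝ} {W' : α → Matrix (Fin m) (Fin m) ℝ}

lemma tendsto_matrix_mul {p q r : Type*} [Fintype q] {A : α → Matrix p q ℝ} {D : α → Matrix q r ℝ}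
    {A₀ : Matrix p q ℝ} {D₀ : Matrix q r ℝ} (hA : Tendsto A l (𝓝 A₀)) (hD : Tendsto D l (𝓝 D₀)) :
    Tendsto (fun x => A x * D x) l (𝓝 (A₀ * D₀)) :=
  ((continuous_fst.matrix_mul continuous_snd).tendsto (A₀, D₀)).comp (hA.prodMk_nhds hD)

lemma tendsto_matrix_inv {ι : Type*} [Fintype ι] [DecidableEq ι] {A : α → Matrix ι ι ℝ}
    {A₀ : Matrix ι ι ℝ} (hA : Tendsto A l (𝓝 A₀)) (hdet : A₀.det ≠ 0) :
    Tendsto (fun x => (A x)⁻¹) l (𝓝 A₀⁻¹) := by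
  have hinv : ContinuousAt Ring.inverse A₀.det := by
    simpa only [Ring.inverse_eq_inv'] using continuousAt_inv₀ hdet
  exact (continuousAt_matrix_inv _ hinv).tendsto.comp hA

lemma tendsto_cols (hB : Tendsto B l (𝓝 C)) :
    Tendsto (fun x => cols (B x) S) l (𝓝 (cols C S)) :=
  ((continuous_id.matrix_submatrix id Subtype.val).tendsto C).comp hB

lemma tendsto_transpose_cols_mul (hB : Tendsto B l (𝓝 C)) (hW : Tendsto W' l (𝓝 W)) :
    Tendsto (fun x => (cols (B x) S)ᵀ * W' x) l (𝓝 ((cols C S)ᵀ * W)) :=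
  tendsto_matrix_mul ((continuous_id.matrix_transpose.tendsto _).comp (tendsto_cols hB)) hW

lemma tendsto_gram (hB : Tendsto B l (𝓝 C)) (hW : Tendsto W' l (𝓝 W)) :
    Tendsto (fun x => (cols (B x) S)ᵀ * W' x * cols (B x) S) l
      (𝓝 ((cols C S)ᵀ * W * cols C S)) :=
  tendsto_matrix_mul (tendsto_transpose_cols_mul hB hW) (tendsto_cols hB)

lemma tendsto_gain (hB : Tendsto B l (𝓝 C)) (hW : Tendsto W' l (𝓝 W))
    (hdet : ((cols C S)ᵀ * W * cols C S).det ≠ 0) :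
    Tendsto (fun x => gain (B x) (W' x) S) l (𝓝 (gain C W S)) :=
  tendsto_matrix_mul tendsto_const_nhds (tendsto_matrix_mul
    (tendsto_matrix_inv (tendsto_gram hB hW) hdet) (tendsto_transpose_cols_mul hB hW))

lemma tendsto_embedBlock_sandwich {O : α → Matrix (Fin m) (Fin m) ℝ}
    {O₀ : Matrix (Fin m) (Fin m) ℝ} {T : α → Finset (Fin d)} (hT : ∀ᶠ x in l, T x = S)
    (hB : Tendsto B l (𝓝 C)) (hW : Tendsto W' l (𝓝 W)) (hO : Tendsto O l (𝓝 O₀))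
    (hdet : ((cols C S)ᵀ * W * cols C S).det ≠ 0) :
    Tendsto (fun x => embedBlock (T x) (sandwich (B x) (W' x) (O x) (T x))) l
      (𝓝 (embedBlock S (sandwich C W O₀ S))) := by
  have hinv := tendsto_matrix_inv (tendsto_gram hB hW) hdet
  have hmeat := tendsto_matrix_mul (tendsto_matrix_mul (tendsto_matrix_mul
    (tendsto_transpose_cols_mul (S := S) hB hW) hO) hW) (tendsto_cols (S := S) hB)
  have hsandwich : Tendsto (fun x => sandwich (B x) (W' x) (O x) S) l (𝓝 (sandwich C W O₀ S)) :=
    tendsto_matrix_mul (tendsto_matrix_mul hinv hmeat) hinv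
  have hembed : Tendsto (fun x => embedBlock S (sandwich (B x) (W' x) (O x) S)) l
      (𝓝 (embedBlock S (sandwich C W O₀ S))) := by
    simp only [embedBlock_eq_mul]
    exact tendsto_matrix_mul (tendsto_matrix_mul tendsto_const_nhds hsandwich) tendsto_const_nhds
  refine hembed.congr' ?_
  filter_upwards [hT] with x hx
  rw [hx]

lemma eventually_sub_eq_gain_mulVec {a : α → Fin m → ℝ} {T : α → Finset (Fin d)}
    {b : α → Fin d → ℝ} {β : Fin d → ℝ} (hβ : ∀ j, j ∉ S → β j = 0) (hT : ∀ᶠ x in l, T x = S)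
    (hB : Tendsto B l (𝓝 C)) (hW : Tendsto W' l (𝓝 W)) (hsymm : ∀ᶠ x in l, (W' x).IsSymm)
    (hdet : ((cols C S)ᵀ * W * cols C S).det ≠ 0)
    (hb : ∀ᶠ x in l, IsRefitGMM (W' x) (a x) (B x) (T x) (b x)) :
    ∀ᶠ x in l, b x - β = gain (B x) (W' x) S *ᵥ (a x - B x *ᵥ β) := by
  have hgram := ((continuous_id.matrix_det.tendsto _).comp
    (tendsto_gram (S := S) hB hW)).eventually_ne hdet
  filter_upwards [hT, hsymm, hb, hgram] with x hTx hsymmx hbx hgramx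
  exact (hTx ▸ hbx).sub_eq_gain_mulVec hsymmx hβ hgramx

end Limits

end Refit

section SampleAlgebra

variable {p q n : ℕ} (c : Centering) (A : ℕ → Fin p → ℝ) (B : ℕ → Fin q → ℝ) (β : Fin q → ℝ)

lemma avg_apply {ι : Type*} (v : ℕ → ι → ℝ) (a : ι) : avg n v a = avg n fun i => v i a := by
  simp [avg]

lemma avg_sum {ι : Type*} (s : Finset ι) (v : ι → ℕ → ℝ) :
    avg n (fun i => ∑ j ∈ s, v j i) = ∑ j ∈ s, avg n (v j) := by
  simp only [avg, smul_eq_mul, Finset.mul_sum]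
  exact Finset.sum_comm

lemma avg_mul_const (v : ℕ → ℝ) (r : ℝ) : avg n (fun i => v i * r) = avg n v * r := by
  simp only [avg, smul_eq_mul, ← Finset.sum_mul, mul_assoc]

lemma avg_const_mul (v : ℕ → ℝ) (r : ℝ) : avg n (fun i => r * v i) = r * avg n v := by
  simp only [mul_comm r, avg_mul_const]

lemma avg_sub (v w : ℕ → ℝ) : avg n (fun i => v i - w i) = avg n v - avg n w := by
  simp only [avg, smul_eq_mul, Finset.sum_sub_distrib, mul_sub]

lemma avg_const (hn : n ≠ 0) (r : ℝ) : avg n (fun _ => r) = r := by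
  simp [avg, hn]

lemma avg_sub_mul_sub (hn : n ≠ 0) (v w : ℕ → ℝ) (s t : ℝ) :
    avg n (fun i => (v i - s) * (w i - t)) =
      avg n (fun i => v i * w i) - avg n v * t - s * avg n w + s * t := by
  have hexpand : ∀ i, (v i - s) * (w i - t) = (v i * w i - v i * t) - (s * w i - s * t) :=
    fun i => by ring
  simp_rw [hexpand]
  rw [avg_sub, avg_sub, avg_sub, avg_mul_const, avg_const_mul, avg_const hn]
  ring

lemma Centering.shift_apply {ι : Type*} (v : ℕ → ι → ℝ) (a : ι) :
    c.shift n v a = c.shift n fun i => v i a := by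
  cases c
  · rfl
  · exact avg_apply v a

lemma Centering.shift_dotProduct :
    (c.shift n fun i => B i ⬝ᵥ β) = ∑ u, (c.shift n fun i => B i u) * β u := by
  cases c
  · simp [Centering.shift]
  · simp only [Centering.shift, dotProduct]
    rw [avg_sum]
    simp_rw [avg_mul_const]

lemma sampleProduct_apply (b : ℕ → ℝ) (i : ℕ) (a : Fin p) : sampleProduct c n A b i a =
    (b i - c.shift n b) * (A i a - c.shift n fun i => A i a) := by
  simp [sampleProduct, Centering.shift_apply]

lemma sampleProduct_dotProduct (i : ℕ) (a : Fin p) :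
    sampleProduct c n A (fun j => B j ⬝ᵥ β) i a =
      ∑ u, sampleProduct c n A (fun j => B j u) i a * β u := by
  simp only [sampleProduct_apply, Centering.shift_dotProduct]
  rw [dotProduct, ← Finset.sum_sub_distrib, Finset.sum_mul]
  exact Finset.sum_congr rfl fun u _ => by ring

lemma sampleCovMat_mulVec :
    sampleCovMat c n A B *ᵥ β = sampleCovVec c n A fun j => B j ⬝ᵥ β := by
  ext a
  simp_rw [sampleCovVec, avg_apply, sampleProduct_dotProduct]
  rw [avg_sum]
  simp_rw [avg_mul_const]
  simp only [sampleCovMat, sampleCovVec, mulVec, dotProduct, of_apply, avg_apply]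

lemma sampleVar_apply (z : ℕ → Fin p → ℝ) (a a' : Fin p) :
    sampleVar n z a a' = avg n (fun i => z i a * z i a') -
      avg n (fun i => z i a) * avg n (fun i => z i a') := by
  rcases eq_or_ne n 0 with rfl | hn
  · simp [sampleVar, avg]
  have hentry : sampleVar n z a a' = avg n fun i =>
      (z i a - avg n fun i => z i a) * (z i a' - avg n fun i => z i a') := by
    simp [sampleVar, avg, Matrix.sum_apply, vecMulVec_apply]
  rw [hentry, avg_sub_mul_sub hn]
  ring

lemma sampleVar_dotProduct (a a' : Fin p) :
    sampleVar n (sampleProduct c n A fun j => B j ⬝ᵥ β) a a' =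
      ∑ u, ∑ v, β u * β v *
        (avg n (fun i => sampleProduct c n A (fun j => B j u) i a *
            sampleProduct c n A (fun j => B j v) i a') -
          avg n (fun i => sampleProduct c n A (fun j => B j u) i a) *
            avg n (fun i => sampleProduct c n A (fun j => B j v) i a')) := by
  rw [sampleVar_apply]
  simp_rw [sampleProduct_dotProduct, Finset.sum_mul_sum, mul_mul_mul_comm _ (β _)]
  rw [avg_sum, avg_sum, avg_sum, Finset.sum_mul_sum, ← Finset.sum_sub_distrib]
  refine Finset.sum_congr rfl fun u _ => ?_
  rw [avg_sum, ← Finset.sum_sub_distrib]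
  refine Finset.sum_congr rfl fun v _ => ?_
  rw [avg_mul_const, avg_mul_const, avg_mul_const]
  ring

end SampleAlgebra

section LawOfLargeNumbers

variable {Ω E ι : Type*} [MeasurableSpace Ω] {P : Measure Ω} {l : Filter ι} {n : ι → ℕ}

lemma tendsto_avg_probFilter [IsFiniteMeasure P] {V : ℕ → Ω → ℝ} {V₀ : Ω → ℝ}
    (hid : ∀ i, IdentDistrib (V i) V₀ P P)
    (hind : Pairwise fun i j => IndepFun (V i) (V j) P) (hint : Integrable V₀ P)
    (hn : Tendsto n l atTop) :
    Tendsto (fun x : ι × Ω => avg (n x.1) fun i => V i x.2) (probFilter l P)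
      (𝓝 (∫ ω, V₀ ω ∂P)) := by
  have hlaw : ∀ᵐ ω ∂P, Tendsto (fun k => avg k fun i => V i ω) atTop (𝓝 (∫ ω, V₀ ω ∂P)) := by
    have h := strong_law_ae_real V ((hid 0).integrable_iff.2 hint) hind
      fun i => (hid i).trans (hid 0).symm
    rw [(hid 0).integral_eq] at h
    simpa only [avg, smul_eq_mul, div_eq_inv_mul] using h
  have hmeas : ∀ k, AEStronglyMeasurable (fun ω => avg k fun i => V i ω) P := fun k => by
    simp only [avg, smul_eq_mul]
    exact ((Finset.aemeasurable_fun_sum _ fun i _ =>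
      (hid i).aemeasurable_fst).const_mul _).aestronglyMeasurable
  exact (tendsto_probFilter_iff_tendstoInMeasure
    (f := fun k ω => avg (n k) fun i => V i ω)).2 fun ε hε =>
      (tendstoInMeasure_of_tendsto_ae hmeas hlaw ε hε).comp hn

variable [NormedAddCommGroup E] [NormedSpace ℝ E] [MeasurableSpace E]

/-- The observations `Z 0, Z 1, …` are i.i.d. copies of `Z₀`, which has a finite fourth moment and
mean zero whenever the convention `c` is to use the data as they are. -/
structure IIDSample (P : Measure Ω) (c : Centering) (Z₀ : Ω → E) (Z : ℕ → Ω → E) : Prop where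
  identDistrib (i : ℕ) : IdentDistrib (Z i) Z₀ P P
  indep : iIndepFun Z P
  memLp : MemLp Z₀ 4 P
  integral_eq_zero : c = .population → ∫ ω, Z₀ ω ∂P = 0

lemma IIDSample.prodMk [IsFiniteMeasure P] [CompleteSpace E] {F : Type*} [NormedAddCommGroup F]
    [NormedSpace ℝ F] [CompleteSpace F] [MeasurableSpace F] {c : Centering} {A₀ : Ω → E}
    {B₀ : Ω → F} {A : ℕ → Ω → E} {B : ℕ → Ω → F}
    (hid : ∀ i, IdentDistrib (fun ω => (A i ω, B i ω)) (fun ω => (A₀ ω, B₀ ω)) P P)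
    (hindep : iIndepFun (fun i ω => (A i ω, B i ω)) P) (hA : MemLp A₀ 4 P) (hB : MemLp B₀ 4 P)
    (hmean : c = .population → ∫ ω, A₀ ω ∂P = 0 ∧ ∫ ω, B₀ ω ∂P = 0) :
    IIDSample P c (fun ω => (A₀ ω, B₀ ω)) fun i ω => (A i ω, B i ω) where
  identDistrib := hid
  indep := hindep
  memLp := .of_fst_snd ⟨hA, hB⟩
  integral_eq_zero hc := by
    rw [integral_pair (hA.integrable (by norm_num)) (hB.integrable (by norm_num)),
      (hmean hc).1, (hmean hc).2, Prod.mk_zero_zero]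

lemma integrable_prod_of_memLp_four [IsFiniteMeasure P] {κ : Type*} {s : Finset κ}
    (hs : s.card ≤ 4) {f : κ → Ω → ℝ} (hf : ∀ j, MemLp (f j) 4 P) :
    Integrable (fun ω => ∏ j ∈ s, f j ω) P := by
  refine (MemLp.prod' (p := fun _ => 4) fun j _ => hf j).integrable ?_
  rw [Finset.sum_const, nsmul_eq_mul, ENNReal.one_le_inv]
  calc (s.card : ENNReal) * 4⁻¹ ≤ 4 * 4⁻¹ := by gcongr; exact_mod_cast hs
    _ = 1 := ENNReal.mul_inv_cancel (by norm_num) (by norm_num)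

lemma memLp_two_centeredProduct [IsFiniteMeasure P] {p : ℕ} {A : Ω → Fin p → ℝ} {b : Ω → ℝ}
    (hA : MemLp A 4 P) (hb : MemLp b 4 P) : MemLp (centeredProduct P A b) 2 P := by
  have : ENNReal.HolderTriple 4 4 2 := ⟨by
    rw [← two_mul, show (4 : ENNReal) = 2 * 2 by norm_num,
      ENNReal.mul_inv (by norm_num) (by norm_num), ← mul_assoc,
      ENNReal.mul_inv_cancel (by norm_num) (by norm_num), one_mul]⟩
  exact .of_eval fun a => ((hA.eval a).sub (memLp_const _)).mul (hb.sub (memLp_const _))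

lemma integral_centeredProduct {p : ℕ} (A : Ω → Fin p → ℝ) (b : Ω → ℝ) (a : Fin p) :
    ∫ ω, centeredProduct P A b ω a ∂P = cov[fun ω => A ω a, b; P] := by
  simp only [covariance, centeredProduct, mul_comm]

lemma centeredProduct_dotProduct {p q : ℕ} (A : Ω → Fin p → ℝ)
    {B : Ω → Fin q → ℝ} (hB : Integrable B P) (β : Fin q → ℝ) (a : Fin p) :
    (fun ω => centeredProduct P A (fun ω => B ω ⬝ᵥ β) ω a) =
      fun ω => ∑ u, β u * centeredProduct P A (fun ω => B ω u) ω a := by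
  ext ω
  simp only [centeredProduct, dotProduct]
  rw [integral_finsetSum _ fun u _ => (hB.eval u).mul_const _, ← Finset.sum_sub_distrib,
    Finset.sum_mul]
  refine Finset.sum_congr rfl fun u _ => ?_
  rw [integral_mul_const]
  ring

namespace IIDSample

variable {c : Centering} {Z₀ : Ω → E} {Z : ℕ → Ω → E}

lemma memLp_clm {F : Type*} [NormedAddCommGroup F] [NormedSpace ℝ F] (hs : IIDSample P c Z₀ Z)
    (f : E →L[ℝ] F) : MemLp (fun ω => f (Z₀ ω)) 4 P :=
  f.comp_memLp' hs.memLp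

lemma integral_clm_eq_zero [IsFiniteMeasure P] [CompleteSpace E] (hs : IIDSample P c Z₀ Z)
    (hc : c = .population) (f : E →L[ℝ] ℝ) : ∫ ω, f (Z₀ ω) ∂P = 0 := by
  rw [f.integral_comp_comm (hs.memLp.integrable (by norm_num)), hs.integral_eq_zero hc, map_zero]

variable [IsProbabilityMeasure P] [BorelSpace E]

lemma tendsto_avg_prod (hs : IIDSample P c Z₀ Z) (hn : Tendsto n l atTop) {κ : Type*}
    {s : Finset κ} (hcard : s.card ≤ 4) (f : κ → E →L[ℝ] ℝ) :
    Tendsto (fun x : ι × Ω => avg (n x.1) fun i => ∏ j ∈ s, f j (Z i x.2)) (probFilter l P)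
      (𝓝 (∫ ω, ∏ j ∈ s, f j (Z₀ ω) ∂P)) := by
  have hmeas : Measurable fun z => ∏ j ∈ s, f j z :=
    Finset.measurable_fun_prod _ fun j _ => (f j).measurable
  exact tendsto_avg_probFilter (V := fun i ω => ∏ j ∈ s, f j (Z i ω))
    (fun i => (hs.identDistrib i).comp hmeas)
    (fun i j hij => (hs.indep.indepFun hij).comp hmeas hmeas)
    (integrable_prod_of_memLp_four hcard fun j => hs.memLp_clm (f j)) hn

variable [CompleteSpace E]

lemma tendsto_shift (hs : IIDSample P c Z₀ Z) (hn : Tendsto n l atTop) (f : E →L[ℝ] ℝ) :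
    Tendsto (fun x : ι × Ω => c.shift (n x.1) fun i => f (Z i x.2)) (probFilter l P)
      (𝓝 (∫ ω, f (Z₀ ω) ∂P)) := by
  cases c
  · simp only [Centering.shift, hs.integral_clm_eq_zero rfl f, tendsto_const_nhds]
  · simpa using! hs.tendsto_avg_prod (s := {()}) hn (by simp) fun _ => f

/-- Expanding the product reduces the claim to moments of the uncentred data. -/
lemma tendsto_avg_prod_sub_shift (hs : IIDSample P c Z₀ Z) (hn : Tendsto n l atTop) {κ : Type*}
    [Fintype κ] (hκ : Fintype.card κ ≤ 4) (f : κ → E →L[ℝ] ℝ) :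
    Tendsto (fun x : ι × Ω => avg (n x.1) fun i =>
        ∏ j, (f j (Z i x.2) - c.shift (n x.1) fun i => f j (Z i x.2))) (probFilter l P)
      (𝓝 (∫ ω, ∏ j, (f j (Z₀ ω) - ∫ ω', f j (Z₀ ω') ∂P) ∂P)) := by
  classical
  have hcard : ∀ s : Finset κ, s.card ≤ 4 := fun s => (Finset.card_le_univ s).trans hκ
  simp_rw [Finset.prod_sub, avg_sum, avg_mul_const, avg_const_mul]
  rw [integral_finsetSum _ fun s _ => ((integrable_prod_of_memLp_four (hcard _)
    fun j => hs.memLp_clm (f j)).const_mul _).mul_const _]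
  simp_rw [integral_mul_const, integral_const_mul]
  exact tendsto_finsetSum _ fun s _ => ((hs.tendsto_avg_prod hn (hcard _) f).const_mul _).mul
    (tendsto_finsetProd _ fun j _ => hs.tendsto_shift hn (f j))

variable {p : ℕ} (A : E →L[ℝ] Fin p → ℝ)

lemma tendsto_avg_sampleProduct (hs : IIDSample P c Z₀ Z) (hn : Tendsto n l atTop)
    (b : E →L[ℝ] ℝ) (a : Fin p) :
    Tendsto (fun x : ι × Ω => avg (n x.1) fun i => sampleProduct c (n x.1)
        (fun i => A (Z i x.2)) (fun i => b (Z i x.2)) i a) (probFilter l P)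
      (𝓝 (cov[fun ω => A (Z₀ ω) a, fun ω => b (Z₀ ω); P])) := by
  have h := hs.tendsto_avg_prod_sub_shift hn (by simp) ![b, (ContinuousLinearMap.proj a).comp A]
  simpa [Fin.prod_univ_two, sampleProduct_apply, centeredProduct, ← integral_centeredProduct]
    using h

lemma tendsto_avg_sampleProduct_mul (hs : IIDSample P c Z₀ Z) (hn : Tendsto n l atTop)
    (b b' : E →L[ℝ] ℝ) (a a' : Fin p) :
    Tendsto (fun x : ι × Ω => avg (n x.1) fun i =>
        sampleProduct c (n x.1) (fun i => A (Z i x.2)) (fun i => b (Z i x.2)) i a *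
        sampleProduct c (n x.1) (fun i => A (Z i x.2)) (fun i => b' (Z i x.2)) i a')
      (probFilter l P)
      (𝓝 (∫ ω, centeredProduct P (fun ω => A (Z₀ ω)) (fun ω => b (Z₀ ω)) ω a *
        centeredProduct P (fun ω => A (Z₀ ω)) (fun ω => b' (Z₀ ω)) ω a' ∂P)) := by
  have h := hs.tendsto_avg_prod_sub_shift hn (by simp)
    ![b, (ContinuousLinearMap.proj a).comp A, b', (ContinuousLinearMap.proj a').comp A]
  simpa [Fin.prod_univ_four, sampleProduct_apply, centeredProduct, mul_assoc] using h

lemma tendsto_sampleCovMat {q : ℕ} (hs : IIDSample P c Z₀ Z) (hn : Tendsto n l atTop)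
    (B : E →L[ℝ] Fin q → ℝ) :
    Tendsto (fun x : ι × Ω => sampleCovMat c (n x.1) (fun i => A (Z i x.2))
      fun i => B (Z i x.2)) (probFilter l P)
      (𝓝 (crossCov P (fun ω => A (Z₀ ω)) fun ω => B (Z₀ ω))) := by
  refine tendsto_pi_nhds.2 fun a => tendsto_pi_nhds.2 fun u => ?_
  simp only [sampleCovMat, sampleCovVec, crossCov, of_apply, avg_apply]
  exact hs.tendsto_avg_sampleProduct A hn ((ContinuousLinearMap.proj u).comp B) a

lemma tendsto_sampleProduct_covariance (hs : IIDSample P c Z₀ Z) (hn : Tendsto n l atTop)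
    (b b' : E →L[ℝ] ℝ) (a a' : Fin p) :
    Tendsto (fun x : ι × Ω =>
        avg (n x.1) (fun i =>
          sampleProduct c (n x.1) (fun i => A (Z i x.2)) (fun i => b (Z i x.2)) i a *
          sampleProduct c (n x.1) (fun i => A (Z i x.2)) (fun i => b' (Z i x.2)) i a') -
        avg (n x.1) (fun i =>
          sampleProduct c (n x.1) (fun i => A (Z i x.2)) (fun i => b (Z i x.2)) i a) *
        avg (n x.1) (fun i =>
          sampleProduct c (n x.1) (fun i => A (Z i x.2)) (fun i => b' (Z i x.2)) i a'))
      (probFilter l P)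
      (𝓝 (cov[fun ω => centeredProduct P (fun ω => A (Z₀ ω)) (fun ω => b (Z₀ ω)) ω a,
        fun ω => centeredProduct P (fun ω => A (Z₀ ω)) (fun ω => b' (Z₀ ω)) ω a'; P])) := by
  rw [covariance_eq_sub
    ((memLp_two_centeredProduct (hs.memLp_clm A) (hs.memLp_clm b)).eval a)
    ((memLp_two_centeredProduct (hs.memLp_clm A) (hs.memLp_clm b')).eval a')]
  refine (hs.tendsto_avg_sampleProduct_mul A hn b b' a a').sub ?_
  simpa only [integral_centeredProduct] using
    (hs.tendsto_avg_sampleProduct A hn b a).mul (hs.tendsto_avg_sampleProduct A hn b' a')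

lemma tendsto_sampleVar (hs : IIDSample P c Z₀ Z) (hn : Tendsto n l atTop) (b : E →L[ℝ] ℝ) :
    Tendsto (fun x : ι × Ω => sampleVar (n x.1) (sampleProduct c (n x.1)
        (fun i => A (Z i x.2)) fun i => b (Z i x.2))) (probFilter l P)
      (𝓝 (crossCov P (centeredProduct P (fun ω => A (Z₀ ω)) fun ω => b (Z₀ ω))
        (centeredProduct P (fun ω => A (Z₀ ω)) fun ω => b (Z₀ ω)))) := by
  refine tendsto_pi_nhds.2 fun a => tendsto_pi_nhds.2 fun a' => ?_
  simp_rw [sampleVar_apply]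
  exact hs.tendsto_sampleProduct_covariance A hn b b a a'

lemma tendsto_sampleVar_dotProduct {q : ℕ} (hs : IIDSample P c Z₀ Z) (hn : Tendsto n l atTop)
    (B : E →L[ℝ] Fin q → ℝ) {b : ι × Ω → Fin q → ℝ} {β : Fin q → ℝ}
    (hb : Tendsto b (probFilter l P) (𝓝 β)) :
    Tendsto (fun x : ι × Ω => sampleVar (n x.1) (sampleProduct c (n x.1)
        (fun i => A (Z i x.2)) fun i => B (Z i x.2) ⬝ᵥ b x)) (probFilter l P)
      (𝓝 (crossCov P (centeredProduct P (fun ω => A (Z₀ ω)) fun ω => B (Z₀ ω) ⬝ᵥ β)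
        (centeredProduct P (fun ω => A (Z₀ ω)) fun ω => B (Z₀ ω) ⬝ᵥ β))) := by
  have hB := (hs.memLp_clm B).integrable (by norm_num)
  have hprod : ∀ u, MemLp (centeredProduct P (fun ω => A (Z₀ ω)) fun ω => B (Z₀ ω) u) 2 P :=
    fun u => memLp_two_centeredProduct (hs.memLp_clm A) ((hs.memLp_clm B).eval u)
  refine tendsto_pi_nhds.2 fun a => tendsto_pi_nhds.2 fun a' => ?_
  simp_rw [sampleVar_dotProduct]
  rw [crossCov, of_apply, centeredProduct_dotProduct _ hB, centeredProduct_dotProduct _ hB,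
    covariance_fun_sum_fun_sum (fun u => ((hprod u).eval a).const_mul _)
      (fun u => ((hprod u).eval a').const_mul _)]
  simp_rw [covariance_const_mul_left, covariance_const_mul_right, ← mul_assoc]
  exact tendsto_finsetSum _ fun u _ => tendsto_finsetSum _ fun v _ =>
    ((tendsto_pi_nhds.1 hb u).mul (tendsto_pi_nhds.1 hb v)).mul
      (hs.tendsto_sampleProduct_covariance A hn ((ContinuousLinearMap.proj u).comp B)
        ((ContinuousLinearMap.proj v).comp B) a a')

end IIDSample

end LawOfLargeNumbers

section AsympNormal

variable {Ω ι : Type*} [MeasurableSpace Ω] {P : Measure Ω} [IsProbabilityMeasure P]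
  {l : Filter ι} {p q : ℕ} {V V' : Matrix (Fin p) (Fin p) ℝ}

/-- `X` converges in distribution to the centred Gaussian with covariance matrix `V`. The vectors
are moved to Euclidean space, where Mathlib's multivariate Gaussian lives. -/
def AsympNormal (l : Filter ι) (P : Measure Ω) [IsProbabilityMeasure P]
    (X : ι → Ω → Fin p → ℝ) (V : Matrix (Fin p) (Fin p) ℝ) : Prop :=
  TendstoInDistribution (fun k ω => WithLp.toLp 2 (X k ω)) l
    (id : EuclideanSpace ℝ (Fin p) → EuclideanSpace ℝ (Fin p)) (fun _ => P)
    (multivariateGaussian 0 V)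

lemma AsympNormal.aemeasurable {X : ι → Ω → Fin p → ℝ} (hX : AsympNormal l P X V) (k : ι) :
    AEMeasurable (X k) P :=
  (WithLp.measurable_ofLp 2 (Fin p → ℝ)).comp_aemeasurable (hX.forall_aemeasurable k)

lemma AsympNormal.comp {ι' : Type*} {l' : Filter ι'} {X : ι → Ω → Fin p → ℝ}
    (hX : AsympNormal l P X V) {n : ι' → ι} (hn : Tendsto n l' l) :
    AsympNormal l' P (fun k => X (n k)) V :=
  ⟨fun k => hX.forall_aemeasurable (n k), aemeasurable_id, hX.tendsto.comp hn⟩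

lemma charFun_multivariateGaussian_zero (hV : V.PosSemidef) (s : EuclideanSpace ℝ (Fin p)) :
    charFun (multivariateGaussian 0 V) s =
      Complex.exp (-((s.ofLp ⬝ᵥ (V *ᵥ s.ofLp) : ℝ) / 2 : ℂ)) := by
  rw [charFun_multivariateGaussian hV]
  simp

lemma map_toLpLin_multivariateGaussian (hV : V.PosSemidef) (G : Matrix (Fin q) (Fin p) ℝ) :
    (multivariateGaussian 0 V).map (G.toLpLin 2 2).toContinuousLinearMap =
      multivariateGaussian 0 (G * V * Gᵀ) := by
  have hGV : (G * V * Gᵀ).PosSemidef := by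
    simpa using hV.mul_mul_conjTranspose_same G
  refine Measure.ext_of_charFun (funext fun s => ?_)
  have hadj : ∀ x : EuclideanSpace ℝ (Fin p),
      inner ℝ (G.toLpLin 2 2 x) s = inner ℝ x (WithLp.toLp 2 (Gᵀ *ᵥ s.ofLp)) := fun x => by
    simp [EuclideanSpace.inner_eq_star_dotProduct, dotProduct_mulVec, vecMul_transpose,
      dotProduct_comm]
  rw [charFun_apply, integral_map (by fun_prop) (by fun_prop)]
  simp only [LinearMap.coe_toContinuousLinearMap', hadj]
  rw [← charFun_apply, charFun_multivariateGaussian_zero hV, charFun_multivariateGaussian_zero hGV,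
    ← mulVec_mulVec, ← mulVec_mulVec, dotProduct_mulVec s.ofLp, ← mulVec_transpose]

lemma AsympNormal.of_eventually_eq_mulVec [l.IsCountablyGenerated] {X : ι → Ω → Fin p → ℝ}
    (hX : AsympNormal l P X V) (hV : V.PosSemidef) {G : ι × Ω → Matrix (Fin q) (Fin p) ℝ}
    {G₀ : Matrix (Fin q) (Fin p) ℝ} (hG : Tendsto G (probFilter l P) (𝓝 G₀))
    {Y : ι → Ω → Fin q → ℝ} (hY : ∀ k, AEMeasurable (Y k) P)
    (hYG : ∀ᶠ x in probFilter l P, Y x.1 x.2 = G x *ᵥ X x.1 x.2) :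
    AsympNormal l P Y (G₀ * V * G₀ᵀ) := by
  have hL : Continuous fun G : Matrix (Fin q) (Fin p) ℝ =>
      (G.toLpLin 2 2).toContinuousLinearMap :=
    LinearMap.continuous_of_finiteDimensional
      ((toLpLin (m := Fin q) (n := Fin p) (R := ℝ) 2 2).trans
        LinearMap.toContinuousLinearMap).toLinearMap
  have h := tendstoInDistribution_of_eventually_eq_apply hX ((hL.tendsto G₀).comp hG)
    (fun k => (WithLp.measurable_toLp 2 (Fin q → ℝ)).comp_aemeasurable (hY k))
    (hYG.mono fun x hx => by simp [hx])
  refine ⟨h.forall_aemeasurable, aemeasurable_id, ?_⟩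
  have hlaw : (multivariateGaussian 0 (G₀ * V * G₀ᵀ)).map id =
      (multivariateGaussian 0 V).map ((G₀.toLpLin 2 2).toContinuousLinearMap ∘ id) := by
    rw [Function.comp_id, Measure.map_id, map_toLpLin_multivariateGaussian hV]
  convert! h.tendsto using 2
  exact congrArg 𝓝 (Subtype.ext hlaw)

lemma AsympNormal.of_tendsto_sub [l.IsCountablyGenerated] {X Y : ι → Ω → Fin p → ℝ}
    (hX : AsympNormal l P X V) (hY : ∀ k, AEMeasurable (Y k) P)
    (hXY : Tendsto (fun x : ι × Ω => Y x.1 x.2 - X x.1 x.2) (probFilter l P) (𝓝 0)) :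
    AsympNormal l P Y V := by
  refine tendstoInDistribution_of_tendstoInMeasure_sub _ _ hX
    (tendsto_probFilter_iff_tendstoInMeasure.1 ?_)
    fun k => (WithLp.measurable_toLp 2 (Fin p → ℝ)).comp_aemeasurable (hY k)
  have h := ((PiLp.continuous_toLp 2 _).tendsto (0 : Fin p → ℝ)).comp hXY
  simpa using! h

lemma AsympNormal.of_eventually_eq_smul [l.IsCountablyGenerated] {X : ι → Ω → Fin p → ℝ}
    (hX : AsympNormal l P X V) (hV : V.PosSemidef) {r : ι → ℝ} {ρ : ℝ} (hr : Tendsto r l (𝓝 ρ))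
    {Y : ι → Ω → Fin p → ℝ} (hY : ∀ k, AEMeasurable (Y k) P)
    (hYr : ∀ᶠ k in l, ∀ ω, Y k ω = r k • X k ω) :
    AsympNormal l P Y (ρ ^ 2 • V) := by
  have hG : Tendsto (fun x : ι × Ω => r x.1 • (1 : Matrix (Fin p) (Fin p) ℝ)) (probFilter l P)
      (𝓝 (ρ • 1)) := (hr.comp tendsto_fst_probFilter).smul_const _
  have h := hX.of_eventually_eq_mulVec hV hG hY
    ((tendsto_fst_probFilter.eventually hYr).mono fun x hx => by simp [hx, smul_mulVec])
  simpa [smul_smul, sq] using h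

lemma AsympNormal.sub {X Y : ℕ → Ω → Fin p → ℝ} (hX : AsympNormal atTop P X V)
    (hY : AsympNormal atTop P Y V') (hV : V.PosSemidef) (hV' : V'.PosSemidef)
    (hXY : ∀ k, IndepFun (X k) (Y k) P) :
    AsympNormal atTop P (fun k ω => X k ω - Y k ω) (V + V') := by
  have hY' := hY.of_eventually_eq_smul hV' (tendsto_const_nhds (x := (-1 : ℝ)))
    (Y := fun k ω => -Y k ω) (fun k => (hY.aemeasurable k).neg) (by simp)
  rw [neg_one_sq, one_smul] at hY'
  refine ⟨fun k => (WithLp.measurable_toLp 2 _).comp_aemeasurable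
    ((hX.aemeasurable k).sub (hY.aemeasurable k)), aemeasurable_id,
    ProbabilityMeasure.tendsto_iff_tendsto_charFun.2 fun s => ?_⟩
  have h := (ProbabilityMeasure.tendsto_iff_tendsto_charFun.1 hX.tendsto s).mul
    (ProbabilityMeasure.tendsto_iff_tendsto_charFun.1 hY'.tendsto s)
  simp only [ProbabilityMeasure.coe_mk, Measure.map_id, charFun_multivariateGaussian_zero hV,
    charFun_multivariateGaussian_zero hV', charFun_multivariateGaussian_zero (hV.add hV')] at h ⊢
  convert! h using 2 with k
  · rw [← Pi.mul_apply, ← IndepFun.charFun_map_fun_add_eq_mul (hX.forall_aemeasurable k)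
      (hY'.forall_aemeasurable k) ((hXY k).comp (WithLp.measurable_toLp 2 _)
        ((WithLp.measurable_toLp 2 _).comp measurable_neg))]
    simp [sub_eq_add_neg]
  · rw [← Complex.exp_add, add_mulVec, dotProduct_add]
    push_cast
    ring_nf

lemma asympNormal_of_dotProduct {X : ℕ → Ω → Fin p → ℝ} (hX : ∀ k, AEMeasurable (X k) P)
    (hV : V.PosSemidef)
    (h : ∀ s : Fin p → ℝ, TendstoInDistribution (fun k ω => s ⬝ᵥ X k ω) atTop
      (id : ℝ → ℝ) (fun _ => P) (gaussianReal 0 (s ⬝ᵥ (V *ᵥ s)).toNNReal)) :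
    AsympNormal atTop P X V := by
  have hX' : ∀ k, AEMeasurable (fun ω => WithLp.toLp 2 (X k ω)) P := fun k =>
    (WithLp.measurable_toLp 2 (Fin p → ℝ)).comp_aemeasurable (hX k)
  refine ⟨hX', aemeasurable_id, ProbabilityMeasure.tendsto_iff_tendsto_charFun.2 fun s => ?_⟩
  have hnonneg : 0 ≤ s.ofLp ⬝ᵥ (V *ᵥ s.ofLp) := by
    simpa using hV.dotProduct_mulVec_nonneg s.ofLp
  have hs := ProbabilityMeasure.tendsto_iff_tendsto_charFun.1 (h s.ofLp).tendsto 1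
  simp only [ProbabilityMeasure.coe_mk, Measure.map_id, charFun_multivariateGaussian_zero hV,
    charFun_gaussianReal] at hs ⊢
  convert! hs using 2 with k
  · rw [charFun_apply, charFun_apply, integral_map (hX' k) (by fun_prop),
      integral_map ((h s.ofLp).forall_aemeasurable k) (by fun_prop)]
    simp [EuclideanSpace.inner_eq_star_dotProduct]
  · simp [hnonneg]

end AsympNormal

section CentralLimit

variable {Ω : Type*} [MeasurableSpace Ω] {P : Measure Ω} {p : ℕ}

lemma variance_dotProduct [IsFiniteMeasure P] {A : Ω → Fin p → ℝ} (hA : MemLp A 2 P)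
    (s : Fin p → ℝ) : Var[fun ω => s ⬝ᵥ A ω; P] = s ⬝ᵥ (crossCov P A A *ᵥ s) := by
  simp only [dotProduct]
  rw [variance_fun_sum fun a => (hA.eval a).const_mul (s a)]
  refine Finset.sum_congr rfl fun a _ => ?_
  rw [mulVec, dotProduct, Finset.mul_sum]
  refine Finset.sum_congr rfl fun a' _ => ?_
  rw [covariance_const_mul_left, covariance_const_mul_right, crossCov, of_apply]
  ring

lemma posSemidef_crossCov [IsFiniteMeasure P] {A : Ω → Fin p → ℝ} (hA : MemLp A 2 P) :
    (crossCov P A A).PosSemidef := by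
  refine .of_dotProduct_mulVec_nonneg ?_ fun s => ?_
  · ext a a'
    simp [crossCov, covariance_comm]
  · rw [star_trivial, ← variance_dotProduct hA]
    exact variance_nonneg _ _

variable [IsProbabilityMeasure P]

lemma tendstoInDistribution_sqrt_mul_avg_sub {V : ℕ → Ω → ℝ} {V₀ : Ω → ℝ}
    (hid : ∀ i, IdentDistrib (V i) V₀ P P) (hind : iIndepFun V P) (hV₀ : MemLp V₀ 2 P) :
    TendstoInDistribution
      (fun (n : ℕ) ω => √(n : ℝ) * (avg n (fun i => V i ω) - ∫ ω, V₀ ω ∂P)) atTop (id : ℝ → ℝ)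
      (fun _ => P) (gaussianReal 0 Var[V₀; P].toNNReal) := by
  have h := tendstoInDistribution_inv_sqrt_mul_sum_sub (P := P) (Y := id)
    (P' := gaussianReal 0 Var[V 0; P].toNNReal) ⟨aemeasurable_id, Measure.map_id⟩
    ((hid 0).memLp_iff.2 hV₀) hind fun i => (hid i).trans (hid 0).symm
  rw [(hid 0).variance_eq, (hid 0).integral_eq] at h
  convert! h using 3 with n ω
  rcases eq_or_ne n 0 with rfl | hn
  · simp
  · have hn' : (n : ℝ) ≠ 0 := Nat.cast_ne_zero.2 hn
    rw [eq_inv_mul_iff_mul_eq₀ (by positivity), ← mul_assoc, Real.mul_self_sqrt (by positivity),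
      avg, smul_eq_mul, mul_sub, mul_inv_cancel_left₀ hn']

lemma asympNormal_sqrt_smul_avg_sub {V : ℕ → Ω → Fin p → ℝ} {V₀ : Ω → Fin p → ℝ}
    (hid : ∀ i, IdentDistrib (V i) V₀ P P) (hind : iIndepFun V P) (hV₀ : MemLp V₀ 2 P) :
    AsympNormal atTop P
      (fun (n : ℕ) ω => √(n : ℝ) • (avg n (fun i => V i ω) - fun a => ∫ ω, V₀ ω a ∂P))
      (crossCov P V₀ V₀) := by
  have hmeas : ∀ n, AEMeasurable (fun ω => avg n fun i => V i ω) P := fun n => by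
    simp only [avg]
    have := fun i => (hid i).aemeasurable_fst
    fun_prop
  refine asympNormal_of_dotProduct (fun n => by fun_prop)
    (posSemidef_crossCov hV₀) fun s => ?_
  have hs : Measurable fun v : Fin p → ℝ => s ⬝ᵥ v := by
    simp only [dotProduct]
    fun_prop
  have hsV : MemLp (fun ω => s ⬝ᵥ V₀ ω) 2 P :=
    memLp_finsetSum _ fun a _ => (hV₀.eval a).const_mul (s a)
  have h := tendstoInDistribution_sqrt_mul_avg_sub (fun i => (hid i).comp hs)
    (hind.comp (fun _ v => s ⬝ᵥ v) fun _ => hs) hsV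
  have hmean : ∫ ω, s ⬝ᵥ V₀ ω ∂P = s ⬝ᵥ fun a => ∫ ω, V₀ ω a ∂P := by
    simp only [dotProduct]
    rw [integral_finsetSum _ fun a _ => ((hV₀.eval a).integrable (by norm_num)).const_mul (s a)]
    simp only [integral_const_mul]
  rw [← variance_dotProduct hV₀]
  convert! h using 3 with n ω
  simp only [Function.comp_apply]
  rw [hmean, dotProduct_smul, dotProduct_sub, smul_eq_mul, avg, avg, dotProduct_smul,
    dotProduct_sum]

end CentralLimit

lemma sampleCovVec_apply {c : Centering} {n p : ℕ} (hn : n ≠ 0) (A : ℕ → Fin p → ℝ) (b : ℕ → ℝ)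
    (a : Fin p) {s t : ℝ} (hs : c = .population → s = 0) (ht : c = .population → t = 0) :
    sampleCovVec c n A b a = avg n (fun i => (b i - s) * (A i a - t)) -
      (c.shift n b - s) * (c.shift n (fun i => A i a) - t) := by
  simp_rw [sampleCovVec, avg_apply, sampleProduct_apply]
  rw [avg_sub_mul_sub hn, avg_sub_mul_sub hn]
  cases c
  · simp [Centering.shift, hs, ht]
  · simp only [Centering.shift]
    ring

variable {Ω E : Type*} [MeasurableSpace Ω] {P : Measure Ω} [NormedAddCommGroup E]
  [NormedSpace ℝ E] [MeasurableSpace E] {p : ℕ}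

lemma measurable_sampleCovVec [BorelSpace E] (c : Centering) (n : ℕ) (A : E →L[ℝ] Fin p → ℝ)
    (b : E →L[ℝ] ℝ) :
    Measurable fun z : ℕ → E => sampleCovVec c n (fun i => A (z i)) fun i => b (z i) := by
  cases c <;> simp only [sampleCovVec, sampleProduct, Centering.shift, avg] <;> fun_prop

namespace IIDSample

variable {c : Centering} {Z₀ : Ω → E} {Z : ℕ → Ω → E}

lemma aemeasurable_data (hs : IIDSample P c Z₀ Z) : AEMeasurable (fun ω i => Z i ω) P :=
  aemeasurable_pi_lambda _ fun i => (hs.identDistrib i).aemeasurable_fst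

variable [IsProbabilityMeasure P] [BorelSpace E] [CompleteSpace E]

lemma bddInProb_sqrt_mul_shift_sub (hs : IIDSample P c Z₀ Z) (f : E →L[ℝ] ℝ) :
    BddInProb atTop P fun (n : ℕ) ω =>
      √(n : ℝ) * (c.shift n (fun i => f (Z i ω)) - ∫ ω, f (Z₀ ω) ∂P) := by
  cases c
  · intro ε _
    refine ⟨1, one_pos, .of_forall fun n => ?_⟩
    simp [Centering.shift, hs.integral_clm_eq_zero rfl f, not_le.2 zero_lt_one]
  · exact bddInProb_of_tendstoInDistribution (tendstoInDistribution_sqrt_mul_avg_sub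
      (fun i => (hs.identDistrib i).comp f.measurable)
      (hs.indep.comp (fun _ => f) fun _ => f.measurable)
      ((hs.memLp_clm f).mono_exponent (by norm_num)))

/-- Estimating the means costs a product of two errors of order `n^{-1/2}`, which does not affect
the limit. -/
lemma asympNormal_sqrt_smul_sampleCovVec_sub (hs : IIDSample P c Z₀ Z) (A : E →L[ℝ] Fin p → ℝ)
    (b : E →L[ℝ] ℝ) :
    AsympNormal atTop P
      (fun (n : ℕ) ω => √(n : ℝ) •
        (sampleCovVec c n (fun i => A (Z i ω)) (fun i => b (Z i ω)) -
          fun a => cov[fun ω => A (Z₀ ω) a, fun ω => b (Z₀ ω); P]))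
      (crossCov P (centeredProduct P (fun ω => A (Z₀ ω)) fun ω => b (Z₀ ω))
        (centeredProduct P (fun ω => A (Z₀ ω)) fun ω => b (Z₀ ω))) := by
  set g : E → Fin p → ℝ := fun z a =>
    (b z - ∫ ω, b (Z₀ ω) ∂P) * (A z a - ∫ ω, A (Z₀ ω) a ∂P) with hg
  have hgm : Measurable g := by fun_prop
  have hclt := asympNormal_sqrt_smul_avg_sub (fun i => (hs.identDistrib i).comp hgm)
    (hs.indep.comp (fun _ => g) fun _ => hgm)
    (memLp_two_centeredProduct (hs.memLp_clm A) (hs.memLp_clm b))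
  refine hclt.of_tendsto_sub (fun n => ?_) (tendsto_pi_nhds.2 fun a => ?_)
  · exact (((measurable_sampleCovVec c n A b).comp_aemeasurable hs.aemeasurable_data).sub_const
      _).const_smul (√(n : ℝ))
  have hAa := fun hc => hs.integral_clm_eq_zero hc ((ContinuousLinearMap.proj a).comp A)
  have hshift := tendsto_sub_nhds_zero_iff.2
    (hs.tendsto_shift tendsto_id ((ContinuousLinearMap.proj a).comp A))
  refine squeeze_zero_norm' ?_
    ((hs.bddInProb_sqrt_mul_shift_sub b).tendsto_norm_mul_norm hshift)
  filter_upwards [tendsto_fst_probFilter.eventually (eventually_ne_atTop 0)] with x hx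
  rw [← norm_mul, ← norm_neg]
  refine le_of_eq (congrArg _ ?_)
  simp only [Pi.sub_apply, Pi.smul_apply, smul_eq_mul, Function.comp_apply, id_eq, avg_apply, hg,
    sampleCovVec_apply hx _ _ a (fun hc => hs.integral_clm_eq_zero hc b) hAa,
    ContinuousLinearMap.comp_apply, ContinuousLinearMap.proj_apply, ← integral_centeredProduct,
    centeredProduct]
  ring

variable {E' : Type*} [NormedAddCommGroup E'] [NormedSpace ℝ E'] [MeasurableSpace E']
  [BorelSpace E'] [CompleteSpace E'] {Z₀' : Ω → E'} {Z' : ℕ → Ω → E'}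

lemma asympNormal_sqrt_total_smul_sampleCovVec_sub {n N : ℕ → ℕ} {τ : ℝ}
    (hs : IIDSample P c Z₀ Z) (hn : Tendsto n atTop atTop) (hτ : 0 < τ)
    (hnN : Tendsto (fun k => (n k : ℝ) / (N k : ℝ)) atTop (𝓝 τ)) (A : E →L[ℝ] Fin p → ℝ)
    (b : E →L[ℝ] ℝ) :
    AsympNormal atTop P
      (fun k ω => √(N k : ℝ) •
        (sampleCovVec c (n k) (fun i => A (Z i ω)) (fun i => b (Z i ω)) -
          fun a => cov[fun ω => A (Z₀ ω) a, fun ω => b (Z₀ ω); P]))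
      (τ⁻¹ • crossCov P (centeredProduct P (fun ω => A (Z₀ ω)) fun ω => b (Z₀ ω))
        (centeredProduct P (fun ω => A (Z₀ ω)) fun ω => b (Z₀ ω))) := by
  rw [← Real.sq_sqrt (inv_nonneg.2 hτ.le)]
  refine ((hs.asympNormal_sqrt_smul_sampleCovVec_sub A b).comp hn).of_eventually_eq_smul
    (posSemidef_crossCov (memLp_two_centeredProduct (hs.memLp_clm A) (hs.memLp_clm b)))
    ((hnN.inv₀ hτ.ne').sqrt) (fun k => ?_) ?_
  · exact (((measurable_sampleCovVec c (n k) A b).comp_aemeasurable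
      hs.aemeasurable_data).sub_const _).const_smul (√(N k : ℝ))
  · filter_upwards [hn.eventually_gt_atTop 0] with k hk ω
    have hk' : (n k : ℝ) ≠ 0 := by positivity
    rw [smul_smul, ← Real.sqrt_mul (by positivity), inv_div, div_mul_cancel₀ _ hk']

theorem asympNormal_sqrt_total_smul_sampleCovVec_sub_sampleCovVec {n n' : ℕ → ℕ} {τ τ' : ℝ}
    (hs : IIDSample P c Z₀ Z) (hs' : IIDSample P c Z₀' Z')
    (hind : IndepFun (fun ω i => Z i ω) (fun ω j => Z' j ω) P)
    (hn : Tendsto n atTop atTop) (hn' : Tendsto n' atTop atTop) (hτ : 0 < τ) (hτ' : 0 < τ')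
    (hnN : Tendsto (fun k => (n k : ℝ) / ((n k + n' k : ℕ) : ℝ)) atTop (𝓝 τ))
    (hnN' : Tendsto (fun k => (n' k : ℝ) / ((n k + n' k : ℕ) : ℝ)) atTop (𝓝 τ'))
    (A : E →L[ℝ] Fin p → ℝ) (b : E →L[ℝ] ℝ) (A' : E' →L[ℝ] Fin p → ℝ) (b' : E' →L[ℝ] ℝ)
    (hcov : ∀ a, cov[fun ω => A (Z₀ ω) a, fun ω => b (Z₀ ω); P] =
      cov[fun ω => A' (Z₀' ω) a, fun ω => b' (Z₀' ω); P]) :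
    AsympNormal atTop P
      (fun k ω => √((n k + n' k : ℕ) : ℝ) •
        (sampleCovVec c (n k) (fun i => A (Z i ω)) (fun i => b (Z i ω)) -
          sampleCovVec c (n' k) (fun j => A' (Z' j ω)) fun j => b' (Z' j ω)))
      (τ⁻¹ • crossCov P (centeredProduct P (fun ω => A (Z₀ ω)) fun ω => b (Z₀ ω))
          (centeredProduct P (fun ω => A (Z₀ ω)) fun ω => b (Z₀ ω)) +
        τ'⁻¹ • crossCov P (centeredProduct P (fun ω => A' (Z₀' ω)) fun ω => b' (Z₀' ω))
          (centeredProduct P (fun ω => A' (Z₀' ω)) fun ω => b' (Z₀' ω))) := by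
  have h := (hs.asympNormal_sqrt_total_smul_sampleCovVec_sub hn hτ hnN A b).sub
    (hs'.asympNormal_sqrt_total_smul_sampleCovVec_sub hn' hτ' hnN' A' b')
    ((posSemidef_crossCov (memLp_two_centeredProduct (hs.memLp_clm A) (hs.memLp_clm b))).smul
      (inv_nonneg.2 hτ.le))
    ((posSemidef_crossCov (memLp_two_centeredProduct (hs'.memLp_clm A') (hs'.memLp_clm b'))).smul
      (inv_nonneg.2 hτ'.le))
    fun k => hind.comp (((measurable_sampleCovVec c (n k) A b).sub_const _).const_smul
      (√((n k + n' k : ℕ) : ℝ))) (((measurable_sampleCovVec c (n' k) A' b').sub_const _).const_smul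
      (√((n k + n' k : ℕ) : ℝ)))
  simp_rw [hcov] at h
  simpa only [← smul_sub, sub_sub_sub_cancel_right] using h

end IIDSample

section Coverage

variable {Ω Ω' ι : Type*} [MeasurableSpace Ω] [MeasurableSpace Ω'] {P : Measure Ω}
  [IsProbabilityMeasure P] {P' : Measure Ω'} [IsProbabilityMeasure P'] {l : Filter ι}

lemma eventually_measure_le_lt_of_tendstoInDistribution {X : ι → Ω → ℝ} {Z : Ω' → ℝ}
    (hX : TendstoInDistribution X l Z (fun _ => P) P') {Y : ι × Ω → ℝ} {y : ℝ}
    (hY : Tendsto Y (probFilter l P) (𝓝 y)) {a : ENNReal} (ha : P' {ω | Z ω ≤ y} < a) :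
    ∀ᶠ k in l, P {ω | X k ω ≤ Y (k, ω)} < a := by
  have hZ : ∀ r, P'.map Z (Set.Iic r) = P' {ω | Z ω ≤ r} := fun r =>
    Measure.map_apply_of_aemeasurable hX.aemeasurable_limit measurableSet_Iic
  obtain ⟨r, hra, hyr⟩ : ∃ r, P' {ω | Z ω ≤ r} < a ∧ y < r := by
    have := Measure.isProbabilityMeasure_map hX.aemeasurable_limit
    have hcont : Tendsto (fun r => P'.map Z (Set.Iic r)) (𝓝[>] y) (𝓝 (P'.map Z (Set.Iic y))) := by
      simp_rw [← ofReal_cdf]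
      exact ENNReal.tendsto_ofReal (((cdf (P'.map Z)).right_continuous y).tendsto.mono_left
        (nhdsWithin_mono y Set.Ioi_subset_Ici_self))
    simp_rw [hZ] at hcont
    exact ((hcont.eventually_lt_const ha).and self_mem_nhdsWithin).exists
  obtain ⟨b, hrb, hba⟩ := exists_between hra
  have hlim : limsup (fun k => P {ω | X k ω ≤ r}) l < b := by
    refine lt_of_le_of_lt ?_ hrb
    rw [← hZ]
    refine (le_of_eq ?_).trans
      (ProbabilityMeasure.limsup_measure_closed_le_of_tendsto hX.tendsto (isClosed_Iic (a := r)))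
    exact congrArg (limsup · l) (funext fun k =>
      (Measure.map_apply_of_aemeasurable (hX.forall_aemeasurable k) measurableSet_Iic).symm)
  have hbad := eventually_probFilter.1 (hY.eventually_lt_const hyr)
  filter_upwards [eventually_lt_of_limsup_lt hlim,
    hbad.eventually_lt_const (tsub_pos_of_lt hba)] with k hk hk'
  calc P {ω | X k ω ≤ Y (k, ω)} ≤ P ({ω | X k ω ≤ r} ∪ {ω | ¬ Y (k, ω) < r}) := by
        refine measure_mono fun ω hω => or_iff_not_imp_right.2 fun h => ?_
        exact le_trans hω (not_not.1 h).le
    _ ≤ P {ω | X k ω ≤ r} + P {ω | ¬ Y (k, ω) < r} := measure_union_le _ _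
    _ < b + (a - b) := ENNReal.add_lt_add hk hk'
    _ = a := add_tsub_cancel_of_le hba.le

/-- The lower bound is the upper bound for the complementary events `{-X ≤ -Y}`. -/
lemma tendsto_measure_le_of_tendstoInDistribution {X : ι → Ω → ℝ} {Z : Ω' → ℝ}
    (hX : TendstoInDistribution X l Z (fun _ => P) P') {Y : ι × Ω → ℝ} {y : ℝ}
    (hY : Tendsto Y (probFilter l P) (𝓝 y)) (hy : P' {ω | Z ω = y} = 0) :
    Tendsto (fun k => P {ω | X k ω ≤ Y (k, ω)}) l (𝓝 (P' {ω | Z ω ≤ y})) := by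
  refine tendsto_order.2 ⟨fun a ha => ?_,
    fun a ha => eventually_measure_le_lt_of_tendstoInDistribution hX hY ha⟩
  have hsum : P' {ω | Z ω ≤ y} + P' {ω | -Z ω ≤ -y} = 1 := by
    have hcompl : {ω | -Z ω ≤ -y} =ᵐ[P'] {ω | Z ω ≤ y}ᶜ := by
      filter_upwards [measure_eq_zero_iff_ae_notMem.1 hy] with ω hω
      have hω' : y ≤ Z ω ↔ y < Z ω := ⟨fun h => lt_of_le_of_ne h (Ne.symm hω), le_of_lt⟩
      exact propext (neg_le_neg_iff.trans (hω'.trans not_le.symm))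
    rw [measure_congr hcompl, ← measure_univ (μ := P')]
    exact measure_add_measure_compl₀
      (hX.aemeasurable_limit.nullMeasurableSet_preimage measurableSet_Iic)
  have hlt : P' {ω | -Z ω ≤ -y} < 1 - a := by
    rw [lt_tsub_iff_left, ← hsum]
    exact ENNReal.add_lt_add_right (measure_ne_top _ _) ha
  filter_upwards [eventually_measure_le_lt_of_tendstoInDistribution
    (hX.continuous_comp continuous_neg) hY.neg hlt] with k hk
  refine (lt_tsub_comm.1 hk).trans_le (tsub_le_iff_right.2 ?_)
  rw [← measure_univ (μ := P)]
  refine (measure_mono fun ω _ => ?_).trans (measure_union_le _ _)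
  exact (le_total (X k ω) (Y (k, ω))).imp_right neg_le_neg

lemma gaussianReal_real_Iic_neg {v : NNReal} (hv : v ≠ 0) (x : ℝ) :
    (gaussianReal 0 v).real (Set.Iic (-x)) = 1 - (gaussianReal 0 v).real (Set.Iic x) := by
  have := nullSingletonClass_gaussianReal (μ := 0) hv
  have hneg : (gaussianReal 0 v).map (fun x => -x) = gaussianReal 0 v := by
    rw [gaussianReal_map_neg, neg_zero]
  rw [← probReal_compl_eq_one_sub measurableSet_Iic, Set.compl_Iic,
    ← measureReal_congr Ioi_ae_eq_Ici.symm]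
  conv_lhs => rw [← hneg]
  rw [map_measureReal_apply (by fun_prop) measurableSet_Iic]
  congr 1
  ext y
  simp

lemma gaussianReal_real_abs_le {v : NNReal} (hv : v ≠ 0) {α z : ℝ} (hα : α < 1)
    (hz : (gaussianReal 0 v).real (Set.Iic z) = 1 - α / 2) :
    (gaussianReal 0 v).real {x | |x| ≤ z} = 1 - α := by
  have hneg := gaussianReal_real_Iic_neg hv z
  have := nullSingletonClass_gaussianReal (μ := 0) hv
  have hlt : -z < z := by
    by_contra! hle
    have := measureReal_mono (μ := gaussianReal 0 v) (Set.Iic_subset_Iic.2 hle)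
    linarith
  have hset : {x : ℝ | |x| ≤ z} = Set.Iic z \ Set.Iio (-z) := by
    ext x
    simp [abs_le, and_comm]
  rw [hset, measureReal_sdiff (Set.Iio_subset_Iic hlt.le) measurableSet_Iio,
    measureReal_congr Iio_ae_eq_Iic, hneg, hz]
  ring

variable {p : ℕ} {V : Matrix (Fin p) (Fin p) ℝ}

lemma AsympNormal.apply_div_sqrt {X : ι → Ω → Fin p → ℝ} (hX : AsympNormal l P X V)
    (hV : V.PosSemidef) {j : Fin p} (hj : 0 < V j j) :
    TendstoInDistribution (fun k ω => X k ω j / √(V j j)) l (id : ℝ → ℝ) (fun _ => P)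
      (gaussianReal 0 1) := by
  have h := hX.continuous_comp (g := fun x : EuclideanSpace ℝ (Fin p) => x j / √(V j j))
    (by fun_prop)
  refine ⟨h.forall_aemeasurable, aemeasurable_id, ?_⟩
  have hlaw : (gaussianReal 0 1).map id =
      (multivariateGaussian 0 V).map ((fun x => x j / √(V j j)) ∘ id) := by
    have hcomp : (fun x : EuclideanSpace ℝ (Fin p) => x j / √(V j j)) =
        (· / √(V j j)) ∘ fun x => x j := rfl
    have hvar : (V j j).toNNReal / .mk (√(V j j) ^ 2) (sq_nonneg _) = 1 := by
      ext
      simp [hj.le, hj.ne']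
    rw [Function.comp_id, Measure.map_id, hcomp,
      ← Measure.map_map (by fun_prop) (by fun_prop),
      (measurePreserving_eval_multivariateGaussian hV).map_eq, gaussianReal_map_div_const, hvar]
    simp
  convert! h.tendsto using 2
  exact congrArg 𝓝 (Subtype.ext hlaw)

lemma mem_waldInterval_iff {z : ℝ} {N : ℕ} (hN : 0 < N) (b : Fin p → ℝ)
    (V : Matrix (Fin p) (Fin p) ℝ) (j : Fin p) (r : ℝ) :
    r ∈ waldInterval z N b V j ↔ |√(N : ℝ) * (b j - r)| ≤ z * √(V j j) := by
  have hN' : (0 : ℝ) < √(N : ℝ) := Real.sqrt_pos.2 (Nat.cast_pos.2 hN)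
  rw [waldInterval, ← Real.closedBall_eq_Icc, Metric.mem_closedBall, dist_comm, Real.dist_eq,
    Real.sqrt_div' _ (Nat.cast_nonneg N), abs_mul, abs_of_pos hN', mul_comm √(N : ℝ),
    ← le_div_iff₀ hN', mul_div_assoc]

theorem AsympNormal.tendsto_measureReal_mem_waldInterval {N : ι → ℕ} {b : ι → Ω → Fin p → ℝ}
    {β : Fin p → ℝ} (hb : AsympNormal l P (fun k ω => √(N k : ℝ) • (b k ω - β)) V)
    (hV : V.PosSemidef) (hN : ∀ᶠ k in l, 0 < N k) {Vhat : ι × Ω → Matrix (Fin p) (Fin p) ℝ}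
    (hVhat : Tendsto Vhat (probFilter l P) (𝓝 V)) {α z : ℝ} (hα : α < 1)
    (hz : (gaussianReal 0 1).real (Set.Iic z) = 1 - α / 2) {j : Fin p} (hj : 0 < V j j) :
    Tendsto (fun k => P.real {ω | β j ∈ waldInterval z (N k) (b k ω) (Vhat (k, ω)) j}) l
      (𝓝 (1 - α)) := by
  have hsd : √(V j j) ≠ 0 := (Real.sqrt_pos.2 hj).ne'
  have hratio : Tendsto (fun x => z * √(Vhat x j j) / √(V j j)) (probFilter l P) (𝓝 z) := by
    have h := ((tendsto_pi_nhds.1 (tendsto_pi_nhds.1 hVhat j) j).sqrt.const_mul z).div_const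
      √(V j j)
    rwa [mul_div_cancel_right₀ z hsd] at h
  have hnull : gaussianReal 0 1 {x | |x| = z} = 0 := by
    have := nullSingletonClass_gaussianReal (μ := 0) (v := 1) one_ne_zero
    exact ((Set.toFinite {z, -z}).subset fun x hx => eq_or_eq_neg_of_abs_eq hx).measure_zero _
  rw [← gaussianReal_real_abs_le one_ne_zero hα hz]
  refine ((ENNReal.tendsto_toReal (measure_ne_top _ _)).comp
    (tendsto_measure_le_of_tendstoInDistribution
      ((hb.apply_div_sqrt hV hj).continuous_comp continuous_abs) hratio hnull)).congr' ?_
  filter_upwards [hN] with k hk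
  refine congrArg P.real (Set.ext fun ω => ?_)
  simp only [Set.mem_ofPred_eq, mem_waldInterval_iff hk, Function.comp_apply, Pi.smul_apply,
    Pi.sub_apply, smul_eq_mul, abs_div, abs_of_pos (Real.sqrt_pos.2 hj),
    div_le_div_iff_of_pos_right (Real.sqrt_pos.2 hj)]

end Coverage

section PostSelection

variable {Ω ι : Type*} [MeasurableSpace Ω] {P : Measure Ω} [IsProbabilityMeasure P]
  {l : Filter ι} {m d : ℕ} {C : Matrix (Fin m) (Fin d) ℝ} {W₀ O : Matrix (Fin m) (Fin m) ℝ}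
  {β : Fin d → ℝ} {N : ι → ℕ} {a : ι → Ω → Fin m → ℝ} {B : ι → Ω → Matrix (Fin m) (Fin d) ℝ}
  {W : ι × Ω → Matrix (Fin m) (Fin m) ℝ}

lemma AsympNormal.tendsto_zero_of_smul {X : ι → Ω → Fin m → ℝ} {r : ι → ℝ}
    (hX : AsympNormal l P (fun k ω => r k • X k ω) O) (hr : Tendsto r l atTop) :
    Tendsto (fun x : ι × Ω => X x.1 x.2) (probFilter l P) (𝓝 0) := by
  simp only [AsympNormal, WithLp.toLp_smul] at hX
  have h := tendsto_probFilter_zero_of_tendstoInDistribution_smul hr hX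
  simpa [Function.comp_def] using
    ((PiLp.continuous_ofLp 2 fun _ : Fin m => ℝ).tendsto 0).comp h

/-- On the scale `(N lam)^{1/2} → ∞` the vector `lam^{-1/2} ĝ(β)` is asymptotically normal, so it
vanishes in the limit: the penalty dominates the noise. -/
lemma eventually_selected_lasso_eq_supp (hRE : RestrictedEigenvalue C W₀ (supp β).card)
    (hg : AsympNormal l P (fun k ω => √(N k : ℝ) • (a k ω - B k ω *ᵥ β)) O)
    (hB : Tendsto (fun x : ι × Ω => B x.1 x.2) (probFilter l P) (𝓝 C))
    (hW : Tendsto W (probFilter l P) (𝓝 W₀))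
    (hWpos : ∀ᶠ x in probFilter l P, (W x).PosSemidef) {lam : ι → ℝ} (hlam : ∀ k, 0 < lam k)
    (hlam0 : Tendsto lam l (𝓝 0)) (hlamN : Tendsto (fun k => (N k : ℝ) * lam k) l atTop)
    {lasso : ι × Ω → Fin d → ℝ}
    (hlasso : ∀ᶠ x in probFilter l P,
      IsLassoGMM (W x) (a x.1 x.2) (B x.1 x.2) (lam x.1) (lasso x))
    {c : ℝ} (hc : 0 < c) (hmin : ∀ j ∈ supp β, c ≤ |β j|) :
    ∀ᶠ x in probFilter l P, selected c (lasso x) = supp β := by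
  have hscale : ∀ k ω, √(N k : ℝ) • (a k ω - B k ω *ᵥ β) =
      √((N k : ℝ) * lam k) • (√(lam k))⁻¹ • (a k ω - B k ω *ᵥ β) := fun k ω => by
    rw [smul_smul, Real.sqrt_mul (Nat.cast_nonneg _),
      mul_inv_cancel_right₀ (Real.sqrt_pos.2 (hlam k)).ne']
  simp_rw [hscale] at hg
  exact eventually_selected_eq_supp hc hmin (tendsto_of_isLassoGMM hRE (fun x => hlam x.1)
    (hlam0.comp tendsto_fst_probFilter) hW hWpos hB
    (hg.tendsto_zero_of_smul (Real.tendsto_sqrt_atTop.comp hlamN)) hlasso)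

lemma asympNormal_of_isRefitGMM [l.IsCountablyGenerated] {S : Finset (Fin d)}
    (hβ : ∀ j, j ∉ S → β j = 0) (hO : O.PosSemidef)
    (hg : AsympNormal l P (fun k ω => √(N k : ℝ) • (a k ω - B k ω *ᵥ β)) O)
    (hB : Tendsto (fun x : ι × Ω => B x.1 x.2) (probFilter l P) (𝓝 C))
    (hW : Tendsto W (probFilter l P) (𝓝 W₀)) (hsymm : ∀ᶠ x in probFilter l P, (W x).IsSymm)
    (hW₀ : W₀.IsSymm) (hdet : ((cols C S)ᵀ * W₀ * cols C S).det ≠ 0)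
    {T : ι × Ω → Finset (Fin d)} (hT : ∀ᶠ x in probFilter l P, T x = S)
    {b : ι → Ω → Fin d → ℝ} (hbm : ∀ k, AEMeasurable (b k) P)
    (hb : ∀ᶠ x in probFilter l P,
      IsRefitGMM (W x) (a x.1 x.2) (B x.1 x.2) (T x) (b x.1 x.2)) :
    AsympNormal l P (fun k ω => √(N k : ℝ) • (b k ω - β))
      (embedBlock S (sandwich C W₀ O S)) := by
  rw [embedBlock_sandwich C hW₀ O]
  refine hg.of_eventually_eq_mulVec hO (tendsto_gain hB hW hdet)
    (fun k => ((hbm k).sub_const β).const_smul √(N k : ℝ)) ?_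
  filter_upwards [eventually_sub_eq_gain_mulVec hβ hT hB hW hsymm hdet hb] with x hx
  rw [hx, mulVec_smul]

lemma posSemidef_embedBlock_sandwich {S : Finset (Fin d)} (hO : O.PosSemidef)
    (hW₀ : W₀.IsSymm) : (embedBlock S (sandwich C W₀ O S)).PosSemidef := by
  rw [embedBlock_sandwich C hW₀ O]
  simpa using hO.mul_mul_conjTranspose_same (gain C W₀ S)

end PostSelection

section Population

lemma tendsto_zero_of_isBigO_one_div_sqrt {ι : Type*} {l : Filter ι} {N : ι → ℕ}
    (hN : Tendsto N l atTop) {lam : ι → ℝ} (h : lam =O[l] fun k => 1 / √(N k : ℝ)) :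
    Tendsto lam l (𝓝 0) := by
  simp only [one_div] at h
  exact h.trans_tendsto (tendsto_inv_atTop_zero.comp
    (Real.tendsto_sqrt_atTop.comp (tendsto_natCast_atTop_atTop.comp hN)))

lemma tendsto_mul_atTop_of_isBigO {ι : Type*} {l : Filter ι} {N : ι → ℕ}
    (hN : Tendsto N l atTop) {lam : ι → ℝ} (hlam : ∀ k, 0 < lam k)
    (h : (fun k => 1 / √(N k : ℝ)) =O[l] lam) : Tendsto (fun k => (N k : ℝ) * lam k) l atTop := by
  obtain ⟨K, hK, hKlam⟩ := h.exists_pos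
  have hsqrt : Tendsto (fun k => √(N k : ℝ)) l atTop :=
    Real.tendsto_sqrt_atTop.comp (tendsto_natCast_atTop_atTop.comp hN)
  refine tendsto_atTop_mono' l ?_ (hsqrt.const_mul_atTop (inv_pos.2 hK))
  filter_upwards [hKlam.bound, hsqrt.eventually_gt_atTop 0] with k hk hNk
  rw [Real.norm_of_nonneg (by positivity), Real.norm_of_nonneg (hlam k).le,
    div_le_iff₀ hNk] at hk
  calc K⁻¹ * √(N k : ℝ) ≤ K⁻¹ * √(N k : ℝ) * (K * lam k * √(N k : ℝ)) :=
        le_mul_of_one_le_right (by positivity) hk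
    _ = √(N k : ℝ) * √(N k : ℝ) * lam k := by field_simp
    _ = N k * lam k := by rw [Real.mul_self_sqrt (Nat.cast_nonneg _)]

variable {Ω : Type*} {m' : MeasurableSpace Ω} [m₀ : MeasurableSpace Ω] {P : Measure Ω}
  [IsProbabilityMeasure P]

lemma crossCov_mulVec_apply {p q : ℕ} {A : Ω → Fin p → ℝ} {B : Ω → Fin q → ℝ}
    (hA : MemLp A 2 P) (hB : MemLp B 2 P) (β : Fin q → ℝ) (a : Fin p) :
    (crossCov P A B *ᵥ β) a = cov[fun ω => A ω a, fun ω => B ω ⬝ᵥ β; P] := by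
  simp only [mulVec, dotProduct, crossCov, of_apply]
  rw [covariance_fun_sum_right (fun u => (hB.eval u).mul_const (β u)) (hA.eval a)]
  exact Finset.sum_congr rfl fun u _ => (covariance_mul_const_right _).symm

lemma covariance_eq_zero_of_condExp_eq_zero (hm : m' ≤ m₀) {f ε : Ω → ℝ}
    (hf : StronglyMeasurable[m'] f) (hf2 : MemLp f 2 P) (hε : MemLp ε 2 P)
    (hexo : P[ε | m'] =ᵐ[P] 0) : cov[f, ε; P] = 0 := by
  have hmean : ∫ ω, ε ω ∂P = 0 := by
    rw [← integral_condExp hm, integral_congr_ae hexo]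
    simp
  have hprod : P[f * ε | m'] =ᵐ[P] 0 := by
    filter_upwards [condExp_mul_of_stronglyMeasurable_left hf (hf2.integrable_mul hε)
      (hε.integrable (by norm_num)), hexo] with ω hω hω'
    rw [hω, Pi.mul_apply, hω', Pi.zero_apply, mul_zero]
  rw [covariance_eq_sub hf2 hε, hmean, mul_zero, sub_zero, ← integral_condExp hm,
    integral_congr_ae hprod]
  simp

lemma covariance_eq_crossCov_mulVec {p q : ℕ} {I : Ω → Fin p → ℝ} {X : Ω → Fin q → ℝ}
    {Y : Ω → ℝ} {β : Fin q → ℝ} (hI : Measurable I) (hI2 : MemLp I 2 P) (hX2 : MemLp X 2 P)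
    (hY2 : MemLp Y 2 P)
    (hexo : P[fun ω => Y ω - X ω ⬝ᵥ β | MeasurableSpace.comap I inferInstance] =ᵐ[P] 0)
    (a : Fin p) : cov[fun ω => I ω a, Y; P] = (crossCov P I X *ᵥ β) a := by
  have hXβ : MemLp (fun ω => X ω ⬝ᵥ β) 2 P :=
    memLp_finsetSum _ fun u _ => (hX2.eval u).mul_const (β u)
  have hIa : StronglyMeasurable[MeasurableSpace.comap I inferInstance] fun ω => I ω a :=
    ((measurable_pi_apply a).comp (comap_measurable I)).stronglyMeasurable
  rw [crossCov_mulVec_apply hI2 hX2, ← sub_eq_zero,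
    ← covariance_fun_sub_right (hI2.eval a) hY2 hXβ]
  exact covariance_eq_zero_of_condExp_eq_zero hI.comap_le hIa (hI2.eval a) (hY2.sub hXβ) hexo

end Population

section TwoSamples

variable {Ω : Type*} [MeasurableSpace Ω] {P : Measure Ω} [IsProbabilityMeasure P] {m d : ℕ}
  {I : Ω → Fin m → ℝ} {Y : Ω → ℝ} {It : Ω → Fin m → ℝ} {Xt : Ω → Fin d → ℝ} {β : Fin d → ℝ}
  {Is : ℕ → Ω → Fin m → ℝ} {Ys : ℕ → Ω → ℝ} {Its : ℕ → Ω → Fin m → ℝ}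
  {Xts : ℕ → Ω → Fin d → ℝ} {cen : Centering} {τ τt : ℝ} {n nt : ℕ → ℕ}

lemma posSemidef_momentVar (hI : MemLp I 4 P) (hY : MemLp Y 4 P) (hIt : MemLp It 4 P)
    (hXt : MemLp Xt 4 P) (hτ : 0 < τ) (hτt : 0 < τt) :
    (momentVar P τ τt I Y It Xt β).PosSemidef :=
  have hXtβ : MemLp (fun ω => Xt ω ⬝ᵥ β) 4 P :=
    memLp_finsetSum _ fun u _ => (hXt.eval u).mul_const (β u)
  ((posSemidef_crossCov (memLp_two_centeredProduct hI hY)).smul (inv_nonneg.2 hτ.le)).add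
    ((posSemidef_crossCov (memLp_two_centeredProduct hIt hXtβ)).smul (inv_nonneg.2 hτt.le))

lemma asympNormal_moment
    (hs : IIDSample P cen (fun ω => (I ω, Y ω)) fun i ω => (Is i ω, Ys i ω))
    (hst : IIDSample P cen (fun ω => (It ω, Xt ω)) fun i ω => (Its i ω, Xts i ω))
    (hind : IndepFun (fun ω (i : ℕ) => (Is i ω, Ys i ω)) (fun ω (i : ℕ) => (Its i ω, Xts i ω)) P)
    (hmom : ∀ a, cov[fun ω => I ω a, Y; P] = (crossCov P It Xt *ᵥ β) a)
    (hn : Tendsto n atTop atTop) (hnt : Tendsto nt atTop atTop) (hτ : 0 < τ) (hτt : 0 < τt)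
    (hnN : Tendsto (fun k => (n k : ℝ) / ((n k + nt k : ℕ) : ℝ)) atTop (𝓝 τ))
    (hntN : Tendsto (fun k => (nt k : ℝ) / ((n k + nt k : ℕ) : ℝ)) atTop (𝓝 τt)) :
    AsympNormal atTop P (fun k ω => √((n k + nt k : ℕ) : ℝ) •
      (sampleCovVec cen (n k) (fun i => Is i ω) (fun i => Ys i ω) -
        sampleCovMat cen (nt k) (fun i => Its i ω) (fun i => Xts i ω) *ᵥ β))
      (momentVar P τ τt I Y It Xt β) := by
  have hIt : MemLp It 2 P := (hst.memLp_clm (.fst ℝ _ _)).mono_exponent (by norm_num)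
  have hXt : MemLp Xt 2 P := (hst.memLp_clm (.snd ℝ _ _)).mono_exponent (by norm_num)
  simp only [crossCov_mulVec_apply hIt hXt] at hmom
  simp_rw [sampleCovMat_mulVec]
  exact hs.asympNormal_sqrt_total_smul_sampleCovVec_sub_sampleCovVec hst hind hn hnt hτ hτt hnN
    hntN (.fst ℝ _ _) (.snd ℝ _ _) (.fst ℝ _ _)
    ((dotProductBilin ℝ ℝ).flip β |>.toContinuousLinearMap.comp (.snd ℝ _ _)) hmom

lemma tendsto_sampleMomentVar
    (hs : IIDSample P cen (fun ω => (I ω, Y ω)) fun i ω => (Is i ω, Ys i ω))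
    (hst : IIDSample P cen (fun ω => (It ω, Xt ω)) fun i ω => (Its i ω, Xts i ω))
    (hn : Tendsto n atTop atTop) (hnt : Tendsto nt atTop atTop) (hτ : τ ≠ 0) (hτt : τt ≠ 0)
    (hnN : Tendsto (fun k => (n k : ℝ) / ((n k + nt k : ℕ) : ℝ)) atTop (𝓝 τ))
    (hntN : Tendsto (fun k => (nt k : ℝ) / ((n k + nt k : ℕ) : ℝ)) atTop (𝓝 τt))
    {b : ℕ × Ω → Fin d → ℝ} (hb : Tendsto b (probFilter atTop P) (𝓝 β)) :
    Tendsto (fun x : ℕ × Ω => sampleMomentVar cen (n x.1) (nt x.1) (fun i => Is i x.2)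
        (fun i => Ys i x.2) (fun i => Its i x.2) (fun i => Xts i x.2) (b x)) (probFilter atTop P)
      (𝓝 (momentVar P τ τt I Y It Xt β)) := by
  have hvar := hs.tendsto_sampleVar (.fst ℝ (Fin m → ℝ) ℝ) hn (.snd ℝ _ _)
  have hvart := hst.tendsto_sampleVar_dotProduct (.fst ℝ (Fin m → ℝ) _) hnt (.snd ℝ _ _) hb
  exact (((hnN.comp tendsto_fst_probFilter).inv₀ hτ).smul hvar).add
    (((hntN.comp tendsto_fst_probFilter).inv₀ hτt).smul hvart)

theorem mainTheorem4_general
    (hs : IIDSample P cen (fun ω => (I ω, Y ω)) fun i ω => (Is i ω, Ys i ω))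
    (hst : IIDSample P cen (fun ω => (It ω, Xt ω)) fun i ω => (Its i ω, Xts i ω))
    (hind : IndepFun (fun ω (i : ℕ) => (Is i ω, Ys i ω)) (fun ω (i : ℕ) => (Its i ω, Xts i ω)) P)
    (hmom : ∀ a, cov[fun ω => I ω a, Y; P] = (crossCov P It Xt *ᵥ β) a)
    (hn : Tendsto n atTop atTop) (hnt : Tendsto nt atTop atTop) (hτ : 0 < τ) (hτt : 0 < τt)
    (hnN : Tendsto (fun k => (n k : ℝ) / ((n k + nt k : ℕ) : ℝ)) atTop (𝓝 τ))
    (hntN : Tendsto (fun k => (nt k : ℝ) / ((n k + nt k : ℕ) : ℝ)) atTop (𝓝 τt))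
    {W W' : ℕ × Ω → Matrix (Fin m) (Fin m) ℝ} {W₀ W'₀ : Matrix (Fin m) (Fin m) ℝ}
    (hWpos : ∀ᶠ x in probFilter atTop P, (W x).PosSemidef)
    (hW : Tendsto W (probFilter atTop P) (𝓝 W₀))
    (hRE : RestrictedEigenvalue (crossCov P It Xt) W₀ (supp β).card)
    {lam : ℕ → ℝ} (hlam : ∀ k, 0 < lam k) (hlam0 : Tendsto lam atTop (𝓝 0))
    (hlamN : Tendsto (fun k => ((n k + nt k : ℕ) : ℝ) * lam k) atTop atTop)
    {lasso : ℕ × Ω → Fin d → ℝ}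
    (hlasso : ∀ᶠ x in probFilter atTop P, IsLassoGMM (W x)
      (sampleCovVec cen (n x.1) (fun i => Is i x.2) (fun i => Ys i x.2))
      (sampleCovMat cen (nt x.1) (fun i => Its i x.2) (fun i => Xts i x.2)) (lam x.1) (lasso x))
    {c : ℝ} (hc : 0 < c) (hmin : ∀ j ∈ supp β, c ≤ |β j|)
    (hW'symm : ∀ᶠ x in probFilter atTop P, (W' x).IsSymm) (hW'₀ : W'₀.PosDef)
    (hW' : Tendsto W' (probFilter atTop P) (𝓝 W'₀))
    {refit : ℕ → Ω → Fin d → ℝ} (hrefitm : ∀ k, AEMeasurable (refit k) P)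
    (hrefit : ∀ᶠ x in probFilter atTop P, IsRefitGMM (W' x)
      (sampleCovVec cen (n x.1) (fun i => Is i x.2) (fun i => Ys i x.2))
      (sampleCovMat cen (nt x.1) (fun i => Its i x.2) (fun i => Xts i x.2))
      (selected c (lasso x)) (refit x.1 x.2)) :
    AsympNormal atTop P (fun k ω => √((n k + nt k : ℕ) : ℝ) • (refit k ω - β))
      (embedBlock (supp β)
        (sandwich (crossCov P It Xt) W'₀ (momentVar P τ τt I Y It Xt β) (supp β))) ∧
    ∀ α < 1, ∀ z : ℝ, (gaussianReal 0 1).real (Set.Iic z) = 1 - α / 2 →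
      ∀ j, 0 < embedBlock (supp β)
          (sandwich (crossCov P It Xt) W'₀ (momentVar P τ τt I Y It Xt β) (supp β)) j j →
        Tendsto (fun k => P.real {ω | β j ∈ waldInterval z (n k + nt k) (refit k ω)
          (embedBlock (selected c (lasso (k, ω)))
            (sandwich (sampleCovMat cen (nt k) (fun i => Its i ω) (fun i => Xts i ω)) (W' (k, ω))
              (sampleMomentVar cen (n k) (nt k) (fun i => Is i ω) (fun i => Ys i ω)
                (fun i => Its i ω) (fun i => Xts i ω) (refit k ω))
              (selected c (lasso (k, ω))))) j}) atTop (𝓝 (1 - α)) := by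
  have hN : Tendsto (fun k => n k + nt k) atTop atTop := hn.atTop_add_nonneg fun _ => zero_le
  have hW'₀symm : W'₀.IsSymm := by simpa using hW'₀.isHermitian
  have hvar : (momentVar P τ τt I Y It Xt β).PosSemidef :=
    posSemidef_momentVar (hs.memLp_clm (.fst ℝ _ _)) (hs.memLp_clm (.snd ℝ _ _))
      (hst.memLp_clm (.fst ℝ _ _)) (hst.memLp_clm (.snd ℝ _ _)) hτ hτt
  have hmoment := asympNormal_moment hs hst hind hmom hn hnt hτ hτt hnN hntN
  have hC := hst.tendsto_sampleCovMat (.fst ℝ _ _) hnt (.snd ℝ _ _)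
  have hdet := hRE.det_gram_ne_zero hW'₀
  have hselected :=
    eventually_selected_lasso_eq_supp hRE hmoment hC hW hWpos hlam hlam0 hlamN hlasso hc hmin
  have hnormal := asympNormal_of_isRefitGMM (fun _ => apply_eq_zero_of_notMem_supp) hvar hmoment
    hC hW' hW'symm hW'₀symm hdet hselected hrefitm hrefit
  have hconsistent : Tendsto (fun x : ℕ × Ω => refit x.1 x.2) (probFilter atTop P) (𝓝 β) :=
    tendsto_sub_nhds_zero_iff.1 (hnormal.tendsto_zero_of_smul
      (Real.tendsto_sqrt_atTop.comp (tendsto_natCast_atTop_atTop.comp hN)))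
  have hplugin := tendsto_embedBlock_sandwich hselected hC hW'
    (tendsto_sampleMomentVar hs hst hn hnt hτ.ne' hτt.ne' hnN hntN hconsistent) hdet
  exact ⟨hnormal, fun α hα z hz j hj => hnormal.tendsto_measureReal_mem_waldInterval
    (posSemidef_embedBlock_sandwich hvar hW'₀symm) (hN.eventually_gt_atTop 0) hplugin hα hz hj⟩

end TwoSamples

end UnpairedIV

open UnpairedIV in
/-- `(I, X, Y)` and `(It, Xt)` are the population variables; `Is, Ys` and `Its, Xts` are the two
observed samples. The `k`-th data set has sizes `n k` and `nt k`, with `N = n k + nt k`. -/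
theorem mainTheorem4 {Ω : Type*} [MeasurableSpace Ω] (P : Measure Ω) [IsProbabilityMeasure P]
    {m d : ℕ}
    -- population variables
    (I : Ω → Fin m → ℝ) (X : Ω → Fin d → ℝ) (Y : Ω → ℝ)
    (It : Ω → Fin m → ℝ) (Xt : Ω → Fin d → ℝ) (β : Fin d → ℝ)
    (hI : Measurable I) (hX : Measurable X) (hY : Measurable Y)
    (hIt : Measurable It) (hXt : Measurable Xt)
    (hI4 : MemLp I 4 P) (hX2 : MemLp X 2 P) (hY4 : MemLp Y 4 P)
    (hIt4 : MemLp It 4 P) (hXt4 : MemLp Xt 4 P)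
    -- equality of the cross-covariances, and exogeneity of the noise `Y - Xᵀ β`
    (hcov : crossCov P It Xt = crossCov P I X)
    (hexo : P[fun ω => Y ω - X ω ⬝ᵥ β | MeasurableSpace.comap I inferInstance] =ᵐ[P] 0)
    -- the two i.i.d. samples, independent of each other
    (Is : ℕ → Ω → Fin m → ℝ) (Ys : ℕ → Ω → ℝ)
    (Its : ℕ → Ω → Fin m → ℝ) (Xts : ℕ → Ω → Fin d → ℝ)
    (hIs : ∀ i, Measurable (Is i)) (hYs : ∀ i, Measurable (Ys i))
    (hIts : ∀ i, Measurable (Its i)) (hXts : ∀ i, Measurable (Xts i))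
    (hid : ∀ i, IdentDistrib (fun ω => (Is i ω, Ys i ω)) (fun ω => (I ω, Y ω)) P P)
    (hindep : iIndepFun (fun i ω => (Is i ω, Ys i ω)) P)
    (hidt : ∀ i, IdentDistrib (fun ω => (Its i ω, Xts i ω)) (fun ω => (It ω, Xt ω)) P P)
    (hindept : iIndepFun (fun i ω => (Its i ω, Xts i ω)) P)
    (hindep2 : IndepFun (fun ω (i : ℕ) => (Is i ω, Ys i ω)) (fun ω (i : ℕ) => (Its i ω, Xts i ω)) P)
    -- centring: by the sample means, or not at all if the population means vanish
    (cen : Centering)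
    (hcen : cen = Centering.population →
      (∫ ω, I ω ∂P) = 0 ∧ (∫ ω, Y ω ∂P) = 0 ∧ (∫ ω, It ω ∂P) = 0 ∧ (∫ ω, Xt ω ∂P) = 0)
    -- sample sizes
    (n nt : ℕ → ℕ) (τ τt : ℝ)
    (hn : Tendsto n atTop atTop) (hnt : Tendsto nt atTop atTop)
    (hτ : τ ∈ Set.Ioo (0 : ℝ) 1) (hτt : τt ∈ Set.Ioo (0 : ℝ) 1)
    (hτlim : Tendsto (fun k => (n k : ℝ) / ((n k + nt k : ℕ) : ℝ)) atTop (𝓝 τ))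
    (hτtlim : Tendsto (fun k => (nt k : ℝ) / ((n k + nt k : ℕ) : ℝ)) atTop (𝓝 τt))
    -- first weight sequence and the restricted eigenvalue condition
    (W : ℕ → Ω → Matrix (Fin m) (Fin m) ℝ) (W₀ : Matrix (Fin m) (Fin m) ℝ)
    (hWmeas : ∀ k a b, AEMeasurable (fun ω => W k ω a b) P)
    (hWpos : ∀ k, ∀ᵐ ω ∂P, (W k ω).PosDef) (hW₀ : W₀.PosDef)
    (hWlim : ∀ a b, TendstoInMeasure P (fun k ω => W k ω a b) atTop fun _ => W₀ a b)
    (hRE : RestrictedEigenvalue (crossCov P It Xt) W₀ (supp β).card)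
    -- penalty of exact order `N^{-1/2}`, the Lasso-GMM, and the beta-min condition
    (lam : ℕ → ℝ) (hlam : ∀ k, 0 < lam k)
    (hlamΘ : lam =Θ[atTop] fun k => 1 / √((n k + nt k : ℕ) : ℝ))
    (lasso : ℕ → Ω → Fin d → ℝ) (hlassoMeas : ∀ k, AEMeasurable (lasso k) P)
    (hlasso : ∀ k, ∀ᵐ ω ∂P, IsLassoGMM (W k ω)
      (sampleCovVec cen (n k) (fun i => Is i ω) (fun i => Ys i ω))
      (sampleCovMat cen (nt k) (fun i => Its i ω) (fun i => Xts i ω)) (lam k) (lasso k ω))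
    (c : ℝ) (hc : 0 < c) (hbetamin : ∀ j ∈ supp β, c ≤ |β j|)
    -- second weight sequence and the refitted estimator on the selected support
    (W' : ℕ → Ω → Matrix (Fin m) (Fin m) ℝ) (W'₀ : Matrix (Fin m) (Fin m) ℝ)
    (hW'meas : ∀ k a b, AEMeasurable (fun ω => W' k ω a b) P)
    (hW'pos : ∀ k, ∀ᵐ ω ∂P, (W' k ω).PosDef) (hW'₀ : W'₀.PosDef)
    (hW'lim : ∀ a b, TendstoInMeasure P (fun k ω => W' k ω a b) atTop fun _ => W'₀ a b)
    (refit : ℕ → Ω → Fin d → ℝ) (hrefitMeas : ∀ k, AEMeasurable (refit k) P)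
    (hrefit : ∀ k, ∀ᵐ ω ∂P, IsRefitGMM (W' k ω)
      (sampleCovVec cen (n k) (fun i => Is i ω) (fun i => Ys i ω))
      (sampleCovMat cen (nt k) (fun i => Its i ω) (fun i => Xts i ω))
      (selected c (lasso k ω)) (refit k ω)) :
    -- asymptotic normality with the sandwich covariance
    TendstoInDistribution
      (fun k ω => √((n k + nt k : ℕ) : ℝ) • WithLp.toLp 2 (refit k ω - β)) atTop
      (id : EuclideanSpace ℝ (Fin d) → EuclideanSpace ℝ (Fin d)) (fun _ => P)
      (multivariateGaussian 0 (embedBlock (supp β)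
        (sandwich (crossCov P I X) W'₀ (momentVar P τ τt I Y It Xt β) (supp β)))) ∧
    -- asymptotic coverage of the Wald intervals with plug-in standard errors
    ∀ α ∈ Set.Ioo (0 : ℝ) 1, ∀ z : ℝ, (gaussianReal 0 1).real (Set.Iic z) = 1 - α / 2 →
      ∀ j, 0 < embedBlock (supp β)
          (sandwich (crossCov P I X) W'₀ (momentVar P τ τt I Y It Xt β) (supp β)) j j →
        Tendsto (fun k => P.real {ω | β j ∈ waldInterval z (n k + nt k) (refit k ω)
          (embedBlock (selected c (lasso k ω))
            (sandwich (sampleCovMat cen (nt k) (fun i => Its i ω) (fun i => Xts i ω)) (W' k ω)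
              (sampleMomentVar cen (n k) (nt k) (fun i => Is i ω) (fun i => Ys i ω)
                (fun i => Its i ω) (fun i => Xts i ω) (refit k ω))
              (selected c (lasso k ω)))) j}) atTop (𝓝 (1 - α)) := by
  have hs : IIDSample P cen (fun ω => (I ω, Y ω)) fun i ω => (Is i ω, Ys i ω) :=
    .prodMk hid hindep hI4 hY4 fun h => ⟨(hcen h).1, (hcen h).2.1⟩
  have hst : IIDSample P cen (fun ω => (It ω, Xt ω)) fun i ω => (Its i ω, Xts i ω) :=
    .prodMk hidt hindept hIt4 hXt4 fun h => (hcen h).2.2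
  have hmom (a : Fin m) : cov[fun ω => I ω a, Y; P] = (crossCov P It Xt *ᵥ β) a := by
    rw [hcov]
    exact covariance_eq_crossCov_mulVec hI (hI4.mono_exponent (by norm_num)) hX2
      (hY4.mono_exponent (by norm_num)) hexo a
  have hN : Tendsto (fun k => n k + nt k) atTop atTop := hn.atTop_add_nonneg fun _ => zero_le
  have hWsemi (k : ℕ) : ∀ᵐ ω ∂P, (W k ω).PosSemidef := (hWpos k).mono fun _ h => h.posSemidef
  have hW'symm (k : ℕ) : ∀ᵐ ω ∂P, (W' k ω).IsSymm :=
    (hW'pos k).mono fun _ h => by simpa using h.isHermitian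
  have hlassoEv := eventually_probFilter_of_ae (l := atTop) hlasso
  have hrefitEv := eventually_probFilter_of_ae (l := atTop) hrefit
  rw [← hcov]
  obtain ⟨hnormal, hcoverage⟩ := mainTheorem4_general (W := fun x => W x.1 x.2)
    (W' := fun x => W' x.1 x.2) (lasso := fun x => lasso x.1 x.2) hs hst hindep2 hmom hn hnt
    hτ.1 hτt.1 hτlim hτtlim (eventually_probFilter_of_ae hWsemi) (tendsto_matrix_probFilter hWlim)
    hRE hlam (tendsto_zero_of_isBigO_one_div_sqrt hN hlamΘ.1)
    (tendsto_mul_atTop_of_isBigO hN hlam hlamΘ.2) hlassoEv hc hbetamin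
    (eventually_probFilter_of_ae hW'symm) hW'₀ (tendsto_matrix_probFilter hW'lim) hrefitMeas
    hrefitEv
  exact ⟨hnormal, fun α hα => hcoverage α hα.2⟩
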